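/- **Theorem 3.5.** Let $b>0$, $p\in(0,1)$, $p+q=1$, and put $b_0=pb$, $b_1=-b$, $b_3=qb$, $b_j=0$ for all other $j$. Let $(X(t))_{t\ge 0}$ be the (regular) Markov branching process with these rates, i.e. a continuous-time Markov chain on $\mathbb Z_+=\{0,1,2,\dots\}$ with càdlàg paths whose honest standard transition function $(p_{ij}(t))$ satisfies $$p_{ij}'(t)=\sum_{k\ge 0}p_{ik}(t)\,q_{kj}\qquad(i\ge 0,\ j\ge 1,\ t\ge 0),$$ where $q_{ij}=i\,b_{j-i+1}$ if $i\ge 1$ and $j\ge i-1$, and $q_{ij}=0$ otherwise. Let $X(0)=1$ almost surely. Let $Y(t)$ be the death number until time $t$, i.e. the number of jumps of $X$ of size $-1$ in $(0,t]$, and put $g_n(t)=P(Y(t)=n)$. (1) For $v\in[0,1]$ let $G(\cdot,1,v)$ be the unique solution on $[0,\infty)$ of $y'=b(pv-y+qy^3)$, $y(0)=1$ (it exists). Then for all $t\ge 0$ $$E[v^{Y(t)}]=G(t,1,v)=\sum_{n=0}^\infty g_n(t)v^n .$$ The functions $g_n$ are continuous on $[0,\infty)$, and for $t\ge 0$ $$g_0(t)=(q+pe^{2bt})^{-1/2},$$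 $$g_n(t)=e^{2bt}(q+pe^{2bt})^{-3/2}\int_0^t e^{-2bs}(q+pe^{2bs})^{3/2}F_n(s)\,ds\qquad(n\ge 1),$$ where $$F_n(t)=bp\,\delta_{1,n}+bq\sum_{\substack{k_1+k_2+k_3=n\\ k_1,k_2,k_3<n}}g_{k_1}(t)g_{k_2}(t)g_{k_3}(t).$$ (2) Let $\tau=\inf\{t\ge 0: X(t)=0\}$ be the extinction time, and define $(g_n)_{n\ge0}$ by $$g_0=0,\qquad g_1=p,\qquad g_n=q\sum_{\substack{i+j+k=n\\ i,j,k<n}}g_ig_jg_k\quad(n\ge 2).$$ Then $P(\tau<\infty)=\rho$, where $\rho$ is the least nonnegative root of $p-u+qu^3=0$, and $\rho=1$ if and only if $q\le 1/3$. Moreover $P(\tau<\infty,\ Y(\tau)=n)=g_n$ for all $n\ge 0$, and for $v\in[0,1]$ $$E\big[v^{Y(\tau)}\mathbf 1_{\{\tau<\infty\}}\big]=\sum_{n=0}^\infty g_nv^n,\qquad E\big[v^{Y(\tau)}\mid\tau<\infty\big]=\rho^{-1}\sum_{n=0}^\infty g_nv^n .$$ In particular, if $q\le 1/3$ then $E[v^{Y(\tau)}\mid\tau<\infty]=\sum_{n\ge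 0}g_nv^n$. -/

import Mathlib

open Set Filter Topology MeasureTheory ProbabilityTheory
open scoped NNReal ENNReal

namespace BranchingDeaths

noncomputable section

/-- The offspring rates of a branching `Q`-matrix: `b j ≥ 0` for `j ≠ 1` and
`0 < -b 1 = ∑_{j ≠ 1} b j < ∞`. -/
structure IsBranchingRates (b : ℕ → ℝ) : Prop where
  nonneg : ∀ j, j ≠ 1 → 0 ≤ b j
  pos : 0 < -b 1
  hasSum : HasSum (fun j => if j = 1 then 0 else b j) (-b 1)

/-- The branching `Q`-matrix: `q i j = i * b (j - i + 1)` if `i ≥ 1` and `j ≥ i - 1`,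
and `q i j = 0` otherwise. -/
def branchingQ (b : ℕ → ℝ) (i j : ℕ) : ℝ :=
  if 1 ≤ i ∧ i ≤ j + 1 then (i : ℝ) * b (j + 1 - i) else 0

/-- A standard honest transition function `P t i j`, `t ≥ 0`, on the state space `ℕ`. -/
structure IsTransitionFunction (P : ℝ → ℕ → ℕ → ℝ) : Prop where
  nonneg : ∀ t, 0 ≤ t → ∀ i j, 0 ≤ P t i j
  honest : ∀ t, 0 ≤ t → ∀ i, HasSum (fun j => P t i j) 1
  zero : ∀ i j, P 0 i j = if i = j then 1 else 0
  chapman_kolmogorov : ∀ s t, 0 ≤ s → 0 ≤ t → ∀ i j,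
    HasSum (fun k => P s i k * P t k j) (P (s + t) i j)
  standard : ∀ i j, Tendsto (fun t => P t i j) (𝓝[>] 0) (𝓝 (if i = j then 1 else 0))

/-- The forward equation `p'_{ij}(t) = ∑_k p_{ik}(t) q_{kj}`, `i ≥ 0`, `j ≥ 1`, `t ≥ 0`, of the
branching `Q`-matrix (only the indices `k ≤ j + 1` contribute to the sum). -/
def ForwardEquation (b : ℕ → ℝ) (P : ℝ → ℕ → ℕ → ℝ) : Prop :=
  ∀ i j, 1 ≤ j → ∀ t, 0 ≤ t →
    HasDerivWithinAt (fun s => P s i j) (∑' k, P t i k * branchingQ b k j) (Ici 0) t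

/-- A right-continuous path in `ℕ` with left limits. -/
def IsCadlagPath (x : ℝ≥0 → ℕ) : Prop :=
  ∀ t, ContinuousWithinAt x (Ici t) t ∧ ∃ l, Tendsto x (𝓝[<] t) (𝓝 l)

variable {Ω : Type*} [MeasurableSpace Ω]

/-- The `σ`-algebra generated by `X r`, `r ≤ s`. -/
abbrev past (X : ℝ≥0 → Ω → ℕ) (s : ℝ≥0) : MeasurableSpace Ω :=
  ⨆ r : Iic s, MeasurableSpace.comap (X r) ⊤

/-- `X` is a (regular) Markov branching process with rates `b` under `μ`: a continuous-time Markov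
chain on `ℕ` with càdlàg paths whose transition function is honest and solves the forward equation
of the branching `Q`-matrix. -/
structure IsMarkovBranchingProcess (b : ℕ → ℝ) (μ : Measure Ω) (X : ℝ≥0 → Ω → ℕ) : Prop where
  rates : IsBranchingRates b
  measurable : ∀ t, Measurable (X t)
  cadlag : ∀ᵐ ω ∂μ, IsCadlagPath (fun t => X t ω)
  markov : ∃ P : ℝ → ℕ → ℕ → ℝ, IsTransitionFunction P ∧ ForwardEquation b P ∧
    ∀ (s h : ℝ≥0) (i j : ℕ) (A : Set Ω), MeasurableSet[past X s] A →
      μ.real (A ∩ {ω | X s ω = i} ∩ {ω | X (s + h) ω = j})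
        = μ.real (A ∩ {ω | X s ω = i}) * P h i j

/-- The times in `(0, t]` at which the path `x` jumps down by one: the value just before `s` is
`x s + 1`. -/
def deathTimes (x : ℝ≥0 → ℕ) (t : ℝ≥0) : Set ℝ≥0 :=
  {s | 0 < s ∧ s ≤ t ∧ ∀ᶠ r in 𝓝[<] s, x r = x s + 1}

/-- A càdlàg path has only finitely many death times up to a given time. -/
theorem deathTimes_finite {x : ℝ≥0 → ℕ} (hx : IsCadlagPath x) (t : ℝ≥0) :
    (deathTimes x t).Finite := by
  have key : ∀ a : ℝ≥0, ∃ U ∈ 𝓝 a, (U ∩ deathTimes x t).Finite := by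
    intro a
    obtain ⟨hr, l, hl⟩ := hx a
    have hl' : ∀ᶠ r in 𝓝[<] a, x r = l := by
      simpa [nhds_discrete] using hl
    have hr' : ∀ᶠ r in 𝓝[≥] a, x r = x a := by
      simpa [ContinuousWithinAt, nhds_discrete] using hr
    have hlU : ∀ᶠ s in 𝓝[<] a, ∀ᶠ r in 𝓝[<] s, x r = x s := by
      have h2 := eventually_eventually_nhdsWithin.2 hl'
      filter_upwards [hl', h2, self_mem_nhdsWithin] with s hs hs2 hsa
      have h3 : ∀ᶠ r in 𝓝[Iio a] s, x r = l := hs2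
      have h4 : 𝓝[<] s ≤ 𝓝[Iio a] s := nhdsWithin_mono _ (Iio_subset_Iio (le_of_lt hsa))
      filter_upwards [h4 h3] with r hr
      rw [hr, hs]
    have hrU : ∀ᶠ s in 𝓝[>] a, ∀ᶠ r in 𝓝[<] s, x r = x s := by
      have hr2 : ∀ᶠ r in 𝓝[>] a, x r = x a := nhdsWithin_mono _ Ioi_subset_Ici_self hr'
      have h2 := eventually_eventually_nhdsWithin.2 hr2
      filter_upwards [hr2, h2, self_mem_nhdsWithin] with s hs hs2 hsa
      have h3 : ∀ᶠ r in 𝓝[Ioi a] s, x r = x a := hs2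
      rw [nhdsWithin_eq_nhds.2 (Ioi_mem_nhds hsa)] at h3
      filter_upwards [nhdsWithin_le_nhds h3] with r hr
      rw [hr, hs]
    have hU : {s | s = a ∨ ∀ᶠ r in 𝓝[<] s, x r = x s} ∈ 𝓝 a := by
      have : ∀ᶠ s in 𝓝[≠] a, ∀ᶠ r in 𝓝[<] s, x r = x s := by
        rw [← Iio_union_Ioi, nhdsWithin_union]
        exact eventually_sup.2 ⟨hlU, hrU⟩
      rw [eventually_nhdsWithin_iff] at this
      filter_upwards [this] with s hs
      by_cases h : s = a
      · exact Or.inl h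
      · exact Or.inr (hs h)
    refine ⟨_, hU, (finite_singleton a).subset ?_⟩
    rintro s ⟨h | h, h0, -, hd⟩
    · exact h
    · exfalso
      have : (𝓝[<] s).NeBot := nhdsLT_neBot_of_exists_lt ⟨0, h0⟩
      obtain ⟨r, h1, h2⟩ := (h.and hd).exists
      omega
  choose U hU hfin using key
  obtain ⟨T, -, hT⟩ := isCompact_Icc.elim_nhds_subcover (s := Icc (0 : ℝ≥0) t) U (fun a _ => hU a)
  refine (T.finite_toSet.biUnion (fun a _ => hfin a)).subset ?_
  intro s hs
  have := hT ⟨zero_le, hs.2.1⟩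
  simp only [mem_iUnion] at this ⊢
  obtain ⟨a, ha, hsa⟩ := this
  exact ⟨a, ha, hsa, hs⟩

/-- The death number of `X` until time `t`. -/
def deathNumber (X : ℝ≥0 → Ω → ℕ) (t : ℝ≥0) (ω : Ω) : ℕ :=
  (deathTimes (fun s => X s ω) t).ncard

/-- The extinction time `τ = inf {t ≥ 0 | X t = 0}`, with `inf ∅ = ∞`. -/
def extinctionTime (X : ℝ≥0 → Ω → ℕ) (ω : Ω) : ℝ≥0∞ :=
  ⨅ (t : ℝ≥0) (_ : X t ω = 0), (t : ℝ≥0∞)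

/-- The event `τ < ∞`. -/
def extinction (X : ℝ≥0 → Ω → ℕ) : Set Ω := {ω | extinctionTime X ω < ∞}

/-- The death number until extinction, `Y(τ)` (meaningful on the event `τ < ∞`). -/
def totalDeaths (X : ℝ≥0 → Ω → ℕ) (ω : Ω) : ℕ :=
  deathNumber X (extinctionTime X ω).toNNReal ω

/-- `g_n(t) = P(Y(t) = n)`, for a real time `t ≥ 0`. -/
def deathProb (μ : Measure Ω) (X : ℝ≥0 → Ω → ℕ) (n : ℕ) (t : ℝ) : ℝ :=
  μ.real {ω | deathNumber X t.toNNReal ω = n}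

/-- The rates `b_0 = p b`, `b_1 = -b`, `b_3 = q b` and `b_j = 0` for all other `j`. -/
def rates03 (b p q : ℝ) (j : ℕ) : ℝ :=
  if j = 0 then p * b else if j = 1 then -b else if j = 3 then q * b else 0

/-- `∑ a i * a j * a k` over `i, j, k < n` with `i + j + k = n`. -/
def cubicConv (a : ℕ → ℝ) (n : ℕ) : ℝ :=
  ∑ x ∈ Finset.range n ×ˢ Finset.range n ×ˢ Finset.range n with x.1 + x.2.1 + x.2.2 = n,
    a x.1 * a x.2.1 * a x.2.2

/-- `y` solves `y' = b (p v - y + q y³)`, `y(0) = 1`, on `[0, ∞)`. -/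
def IsSolution (b p q v : ℝ) (y : ℝ → ℝ) : Prop :=
  y 0 = 1 ∧ ∀ t, 0 ≤ t → HasDerivWithinAt y (b * (p * v - y t + q * y t ^ 3)) (Ici 0) t

end

end BranchingDeaths

/-! The core is the joint generating function: for `w < 1`, `E[v ^ Y(t) * w ^ X(t)] = y t`, where
`y` solves `y' = b (p v - y + q y³)` with `y 0 = w`
(`IsMarkovBranchingProcess.integral_pow_mul_pow`). The two parts of the theorem come from `w → 1`
and from `w = 0`.

For `v = 1` this is the branching property `∑ j, P t i j * u ^ j = z t ^ i`. It follows from the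
forward equation by following the generating function along characteristics (`tsum_sub_tsum_eq`,
`hasSum_transition_mul_pow`). For general `v`, time is cut into `N` steps and a death is counted
whenever the state drops by exactly one over a step. The one-step expectation weighted in this way
agrees with the flow up to `O(h²)`, uniformly in the state (`exists_abs_weighted_sub_le`); by the
Markov property the `N` errors add up to `O(1/N)`. On a càdlàg path the discrete count equals `Y(t)`
once the mesh is fine (`eventually_stepDeaths_eq`).

Letting `w → 1` gives `E[v ^ Y(t)]`. Comparing coefficients of `v ^ n` in the integrated equation
yields an infinite system for the `g_n`. Its equation for `g_0` is of Bernoulli type, and that for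
`g_n` is linear once the lower coefficients are known, so an integrating factor solves it
(`IsMarkovBranchingProcess.deathProb_eq`).

With `w = 0` the flow is `E[v ^ Y(t); X(t) = 0]`. Since `0` is absorbing, this tends to `E[v ^ Y(τ);
τ < ∞]`, and the limit of a flow is stationary. Hence this generating function `H` satisfies `p v -
H + q H³ = 0`, whose coefficients are the recursion. At `v = 1` a comparison with constant flows
singles out the least root. -/

namespace BranchingDeaths

/-! ### The differential equation -/

/-- The constraints on the parameters `b`, `p`, `q`. -/
structure Admissible (b p q : ℝ) : Prop where
  b_pos : 0 < b
  p_pos : 0 < p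
  q_pos : 0 < q
  add_eq_one : p + q = 1

/-- The vector field `b (p v - y + q y³)`. -/
def drift (b p q v y : ℝ) : ℝ := b * (p * v - y + q * y ^ 3)

/-- `y` solves `y' = drift b p q v y`, `y 0 = w`, on `[0, ∞)`, with values in `[0, 1]`. -/
structure IsFlow (b p q v w : ℝ) (y : ℝ → ℝ) : Prop where
  init : y 0 = w
  deriv : ∀ t, 0 ≤ t → HasDerivWithinAt y (drift b p q v (y t)) (Ici 0) t
  mem : ∀ t, 0 ≤ t → y t ∈ Icc (0 : ℝ) 1

theorem continuous_drift (b p q v : ℝ) : Continuous (drift b p q v) := by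
  unfold drift; fun_prop

theorem le_of_hasDerivWithinAt_nonneg {f f' : ℝ → ℝ} {t : ℝ} (ht : 0 ≤ t)
    (hf : ∀ s ∈ Icc 0 t, HasDerivWithinAt f (f' s) (Ici 0) s)
    (h : ∀ s ∈ Icc 0 t, 0 ≤ f' s) : f 0 ≤ f t := by
  refine image_le_of_deriv_right_le_deriv_boundary (f := fun _ => f 0) (f' := fun _ => 0)
    (B := f) (B' := f') (a := 0) (b := t) continuousOn_const
    (fun x _ => hasDerivWithinAt_const _ _ _) le_rfl
    (fun s hs => ((hf s hs).continuousWithinAt).mono Icc_subset_Ici_self)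
    (fun s hs => (hf s (Ico_subset_Icc_self hs)).mono (Ici_subset_Ici.2 hs.1))
    (fun s hs => h s (Ico_subset_Icc_self hs)) (right_mem_Icc.2 ht)

/-- The difference quotient is `b (-1 + q (x² + x y + y²))`. Since `q ≤ 1` and `1 ≤ M²`, its modulus
is at most `b (1 + 3 M²) ≤ 4 b M²`. -/
theorem abs_drift_sub_le {b p q v M x y : ℝ} (h : Admissible b p q) (hM : 1 ≤ M)
    (hx : |x| ≤ M) (hy : |y| ≤ M) :
    |drift b p q v x - drift b p q v y| ≤ b * (4 * M ^ 2) * |x - y| := by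
  have hb := h.b_pos
  have hq := h.q_pos
  have hq1 : q ≤ 1 := by linarith [h.p_pos, h.add_eq_one]
  have e : drift b p q v x - drift b p q v y
      = b * (-1 + q * (x ^ 2 + x * y + y ^ 2)) * (x - y) := by
    unfold drift; ring
  rw [e, abs_mul, abs_mul, abs_of_pos hb]
  have h1 : |x ^ 2 + x * y + y ^ 2| ≤ 3 * M ^ 2 := by
    have hxx : |x ^ 2| ≤ M ^ 2 := by rw [abs_pow]; gcongr
    have hyy : |y ^ 2| ≤ M ^ 2 := by rw [abs_pow]; gcongr
    have hxy : |x * y| ≤ M ^ 2 := by rw [abs_mul, sq]; gcongr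
    calc |x ^ 2 + x * y + y ^ 2| ≤ |x ^ 2| + |x * y| + |y ^ 2| := abs_add_three _ _ _
      _ ≤ 3 * M ^ 2 := by linarith
  have h2 : |(-1 : ℝ) + q * (x ^ 2 + x * y + y ^ 2)| ≤ 4 * M ^ 2 := by
    calc |(-1 : ℝ) + q * (x ^ 2 + x * y + y ^ 2)|
        ≤ |(-1 : ℝ)| + |q * (x ^ 2 + x * y + y ^ 2)| := abs_add_le _ _
      _ = 1 + q * |x ^ 2 + x * y + y ^ 2| := by rw [abs_mul, abs_of_pos hq]; simp
      _ ≤ 1 + 1 * (3 * M ^ 2) := by gcongr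
      _ ≤ 4 * M ^ 2 := by nlinarith
  gcongr

theorem lipschitzOnWith_drift {b p q v M : ℝ} (h : Admissible b p q) (hM : 1 ≤ M) :
    LipschitzOnWith (b * (4 * M ^ 2)).toNNReal (drift b p q v) {x | |x| ≤ M} := by
  refine LipschitzOnWith.of_dist_le_mul fun x hx y hy => ?_
  rw [Real.coe_toNNReal _ (by have := h.b_pos; positivity), Real.dist_eq, Real.dist_eq]
  exact abs_drift_sub_le h hM hx hy

/-- Two solutions on `[0, T]` that stay bounded by `M` separate at most exponentially. -/
theorem dist_le_of_drift {b p q v M T : ℝ} (h : Admissible b p q) (hM : 1 ≤ M) {f g : ℝ → ℝ}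
    (hf : ContinuousOn f (Icc 0 T)) (hg : ContinuousOn g (Icc 0 T))
    (hf' : ∀ t ∈ Ico 0 T, HasDerivWithinAt f (drift b p q v (f t)) (Ici t) t)
    (hg' : ∀ t ∈ Ico 0 T, HasDerivWithinAt g (drift b p q v (g t)) (Ici t) t)
    (hfM : ∀ t ∈ Ico 0 T, |f t| ≤ M) (hgM : ∀ t ∈ Ico 0 T, |g t| ≤ M) {t : ℝ} (ht : t ∈ Icc 0 T) :
    |f t - g t| ≤ |f 0 - g 0| * Real.exp (b * (4 * M ^ 2) * t) := by
  have := dist_le_of_trajectories_ODE_of_mem (v := fun _ => drift b p q v)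
    (s := fun _ => {x | |x| ≤ M}) (fun _ _ => lipschitzOnWith_drift h hM) hf hf' hfM hg hg' hgM
    le_rfl t ht
  rwa [Real.coe_toNNReal _ (by have := h.b_pos; positivity), Real.dist_eq, Real.dist_eq,
    sub_zero] at this

/-- The cubic is only locally Lipschitz, but two continuous functions on a compact interval have a
common bound `M`, so uniqueness needs no a priori estimate. -/
theorem eq_of_drift {b p q v T : ℝ} (h : Admissible b p q) {f g : ℝ → ℝ}
    (hf : ContinuousOn f (Icc 0 T)) (hg : ContinuousOn g (Icc 0 T))
    (hf' : ∀ t ∈ Ico 0 T, HasDerivWithinAt f (drift b p q v (f t)) (Ici t) t)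
    (hg' : ∀ t ∈ Ico 0 T, HasDerivWithinAt g (drift b p q v (g t)) (Ici t) t)
    (h0 : f 0 = g 0) {t : ℝ} (ht : t ∈ Icc 0 T) : f t = g t := by
  obtain ⟨A, hA⟩ := isCompact_Icc.exists_bound_of_continuousOn hf
  obtain ⟨B, hB⟩ := isCompact_Icc.exists_bound_of_continuousOn hg
  have := dist_le_of_drift (M := max 1 (max A B)) h (le_max_left _ _) hf hg hf' hg'
    (fun t ht => (hA t (Ico_subset_Icc_self ht)).trans (by simp))
    (fun t ht => (hB t (Ico_subset_Icc_self ht)).trans (by simp)) ht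
  rw [h0, sub_self, abs_zero, zero_mul] at this
  exact sub_eq_zero.1 (abs_nonpos_iff.1 this)

theorem isFlow_unique {b p q v : ℝ} (h : Admissible b p q) {f g : ℝ → ℝ}
    (hf : ∀ t, 0 ≤ t → HasDerivWithinAt f (drift b p q v (f t)) (Ici 0) t)
    (hg : ∀ t, 0 ≤ t → HasDerivWithinAt g (drift b p q v (g t)) (Ici 0) t)
    (h0 : f 0 = g 0) {t : ℝ} (ht : 0 ≤ t) : f t = g t :=
  eq_of_drift (T := t) h
    (fun s hs => ((hf s hs.1).continuousWithinAt).mono Icc_subset_Ici_self)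
    (fun s hs => ((hg s hs.1).continuousWithinAt).mono Icc_subset_Ici_self)
    (fun s hs => (hf s hs.1).mono (Ici_subset_Ici.2 hs.1))
    (fun s hs => (hg s hs.1).mono (Ici_subset_Ici.2 hs.1)) h0 (right_mem_Icc.2 ht)

theorem IsFlow.continuousOn {b p q v w : ℝ} {y : ℝ → ℝ} (hy : IsFlow b p q v w y) :
    ContinuousOn y (Ici 0) := fun t ht => (hy.deriv t ht).continuousWithinAt

theorem IsFlow.dist_le {b p q v w w' : ℝ} (h : Admissible b p q) {y z : ℝ → ℝ}
    (hy : IsFlow b p q v w y) (hz : IsFlow b p q v w' z) {t : ℝ} (ht : 0 ≤ t) :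
    |y t - z t| ≤ |w - w'| * Real.exp (b * 4 * t) := by
  have := dist_le_of_drift (M := 1) (T := t) h le_rfl
    (hy.continuousOn.mono Icc_subset_Ici_self) (hz.continuousOn.mono Icc_subset_Ici_self)
    (fun s hs => (hy.deriv s hs.1).mono (Ici_subset_Ici.2 hs.1))
    (fun s hs => (hz.deriv s hs.1).mono (Ici_subset_Ici.2 hs.1))
    (fun s hs => abs_le.2 ⟨by linarith [(hy.mem s hs.1).1], (hy.mem s hs.1).2⟩)
    (fun s hs => abs_le.2 ⟨by linarith [(hz.mem s hs.1).1], (hz.mem s hs.1).2⟩)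
    (right_mem_Icc.2 ht)
  simpa [hy.init, hz.init] using this

theorem IsFlow.shift {b p q v w : ℝ} {y : ℝ → ℝ} (hy : IsFlow b p q v w y) {s : ℝ} (hs : 0 ≤ s) :
    IsFlow b p q v (y s) (fun t => y (s + t)) where
  init := by simp
  deriv t ht := by
    have h1 := hy.deriv (s + t) (by positivity)
    have h2 : HasDerivWithinAt (fun t => s + t) 1 (Ici 0) t :=
      ((hasDerivAt_id t).const_add s).hasDerivWithinAt
    simpa [Function.comp_def] using
      HasDerivWithinAt.comp t h1 h2 (fun r hr => mem_Ici.2 (add_nonneg hs hr))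
  mem t ht := hy.mem _ (by positivity)

theorem abs_drift_le {b p q v y : ℝ} (h : Admissible b p q) (hv : v ∈ Icc (0 : ℝ) 1)
    (hy : y ∈ Icc (0 : ℝ) 1) : |drift b p q v y| ≤ b := by
  have hb := h.b_pos
  have hpv : p * v ≤ p := by nlinarith [hv.2, h.p_pos]
  have hpv0 : 0 ≤ p * v := mul_nonneg h.p_pos.le hv.1
  have hy3 : y ^ 3 ≤ y := by
    calc y ^ 3 ≤ y ^ 1 := pow_le_pow_of_le_one hy.1 hy.2 (by norm_num)
      _ = y := pow_one y
  have hy3' : 0 ≤ y ^ 3 := pow_nonneg hy.1 3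
  have hq3 : q * y ^ 3 ≤ q := by nlinarith [h.q_pos, hy.2]
  have hq3' : 0 ≤ q * y ^ 3 := mul_nonneg h.q_pos.le hy3'
  unfold drift
  rw [abs_mul, abs_of_pos hb]
  have : |p * v - y + q * y ^ 3| ≤ 1 := by
    rw [abs_le]; constructor <;> nlinarith [h.add_eq_one, hy.1, hy.2]
  nlinarith

/-- A solution of the equation with the right-hand side frozen outside `[0, 1]` stays in
`[0, 1]`. -/
theorem mem_Icc_of_drift_projIcc {b p q v T : ℝ} (h : Admissible b p q) (hv : v ∈ Icc (0 : ℝ) 1)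
    {y : ℝ → ℝ} (h0 : y 0 ∈ Icc (0 : ℝ) 1)
    (hy : ∀ t ∈ Icc 0 T,
      HasDerivWithinAt y (drift b p q v (projIcc (0 : ℝ) 1 zero_le_one (y t))) (Icc 0 T) t)
    {t : ℝ} (ht : t ∈ Icc 0 T) : y t ∈ Icc (0 : ℝ) 1 := by
  have hT : (0 : ℝ) ≤ T := ht.1.trans ht.2
  have hc : ContinuousOn y (Icc 0 T) := fun s hs => (hy s hs).continuousWithinAt
  have hd : ∀ s ∈ Ico 0 T, HasDerivWithinAt y
      (drift b p q v (projIcc (0 : ℝ) 1 zero_le_one (y s))) (Ici s) s := fun s hs =>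
    ((hy s (Ico_subset_Icc_self hs)).mono (Icc_subset_Icc_left hs.1)).mono_of_mem_nhdsWithin
      (Icc_mem_nhdsGE hs.2)
  have hd0 : drift b p q v 1 ≤ 0 := by
    unfold drift
    have : p * v ≤ p := by nlinarith [hv.2, h.p_pos]
    nlinarith [h.b_pos, h.add_eq_one]
  have hd1 : 0 ≤ drift b p q v 0 := by
    unfold drift
    have : 0 ≤ p * v := mul_nonneg h.p_pos.le hv.1
    have := h.b_pos
    simp; positivity
  -- A barrier of slope `ε > 0`: where `y` touches it, `y ≥ 1`, so the frozen drift is that at `1`,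
  -- which is at most `0 < ε`. The lower barrier is symmetric, and then `ε → 0`.
  have upper : ∀ ε > 0, y t ≤ 1 + ε * (1 + t) := by
    intro ε hε
    refine image_le_of_deriv_right_lt_deriv_boundary hc hd (B := fun t => 1 + ε * (1 + t))
      (B' := fun _ => ε) ?_ (fun x => ?_) (fun x hx e => ?_) ht
    · simpa using h0.2.trans (by linarith)
    · simpa using (((hasDerivAt_id x).const_add 1).const_mul ε).const_add 1
    · have : 1 ≤ y x := by rw [e]; nlinarith [hx.1]
      rw [projIcc_of_right_le _ this]
      exact hd0.trans_lt hε
  have lower : ∀ ε > 0, -y t ≤ ε * (1 + t) := by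
    intro ε hε
    refine image_le_of_deriv_right_lt_deriv_boundary hc.neg (fun s hs => (hd s hs).neg)
      (B := fun t => ε * (1 + t)) (B' := fun _ => ε) ?_ (fun x => ?_) (fun x hx e => ?_) ht
    · simp; linarith [h0.1]
    · simpa using (((hasDerivAt_id x).const_add 1).const_mul ε)
    · have : y x ≤ 0 := by
        have e' : -y x = ε * (1 + x) := e
        nlinarith [hx.1]
      rw [projIcc_of_le_left _ this]
      simp only; linarith
  have h1t : 0 < 1 + t := by linarith [ht.1]
  constructor
  · refine le_of_forall_pos_lt_add fun δ hδ => ?_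
    have := lower (δ / 2 / (1 + t)) (by positivity)
    rw [div_mul_cancel₀ _ h1t.ne'] at this
    linarith
  · refine le_of_forall_pos_lt_add fun δ hδ => ?_
    have := upper (δ / 2 / (1 + t)) (by positivity)
    rw [div_mul_cancel₀ _ h1t.ne'] at this
    linarith

/-- Frozen outside `[0, 1]`, the drift is globally Lipschitz and bounded by `b`, so Picard–Lindelöf
with radius `b T` covers all of `[0, T]`. Invariance of `[0, 1]` then removes the freezing. -/
theorem exists_flow_Icc {b p q v w T : ℝ} (h : Admissible b p q) (hv : v ∈ Icc (0 : ℝ) 1)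
    (hw : w ∈ Icc (0 : ℝ) 1) (hT : 0 ≤ T) :
    ∃ y : ℝ → ℝ, y 0 = w ∧ (∀ t ∈ Icc 0 T, HasDerivWithinAt y (drift b p q v (y t)) (Icc 0 T) t) ∧
      ∀ t ∈ Icc 0 T, y t ∈ Icc (0 : ℝ) 1 := by
  have hb := h.b_pos
  set F : ℝ → ℝ := fun x => drift b p q v (projIcc (0 : ℝ) 1 zero_le_one x) with hF
  have hP : IsPicardLindelof (fun _ : ℝ => F) (tmin := 0) (tmax := T) ⟨0, le_rfl, hT⟩ w
      (b.toNNReal * T.toNNReal) 0 b.toNNReal (b * (4 * 1 ^ 2)).toNNReal := by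
    refine ⟨fun t _ => ?_, fun x _ => continuousOn_const, fun t _ x _ => ?_, ?_⟩
    · refine LipschitzOnWith.of_dist_le_mul fun x _ y _ => ?_
      rw [Real.coe_toNNReal _ (by positivity), Real.dist_eq, Real.dist_eq]
      have hm : ∀ z : ℝ, |(projIcc (0 : ℝ) 1 zero_le_one z : ℝ)| ≤ 1 := fun z => by
        have := (projIcc (0 : ℝ) 1 zero_le_one z).2
        exact abs_le.2 ⟨by linarith [this.1], this.2⟩
      refine (abs_drift_sub_le h le_rfl (hm x) (hm y)).trans ?_
      have := (LipschitzWith.projIcc (zero_le_one' ℝ)).dist_le_mul x y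
      rw [NNReal.coe_one, one_mul, Subtype.dist_eq, Real.dist_eq, Real.dist_eq] at this
      exact mul_le_mul_of_nonneg_left this (by positivity)
    · rw [Real.norm_eq_abs, Real.coe_toNNReal _ hb.le]
      exact abs_drift_le h hv (projIcc (0 : ℝ) 1 zero_le_one x).2
    · simp [Real.coe_toNNReal _ hb.le, Real.coe_toNNReal _ hT, hT]
  obtain ⟨y, hy0, hy⟩ := hP.exists_eq_forall_mem_Icc_hasDerivWithinAt₀
  have hm : ∀ t ∈ Icc 0 T, y t ∈ Icc (0 : ℝ) 1 := fun t ht =>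
    mem_Icc_of_drift_projIcc h hv (by simpa [hy0] using hw) hy ht
  refine ⟨y, hy0, fun t ht => ?_, hm⟩
  have := hy t ht
  simp only [hF] at this
  rwa [projIcc_of_mem _ (hm t ht)] at this

theorem exists_isFlow {b p q v w : ℝ} (h : Admissible b p q) (hv : v ∈ Icc (0 : ℝ) 1)
    (hw : w ∈ Icc (0 : ℝ) 1) : ∃ y : ℝ → ℝ, IsFlow b p q v w y := by
  have H : ∀ T : ℝ≥0, _ := fun T => exists_flow_Icc h hv hw T.coe_nonneg
  choose α h0 hd hm using H
  have hE : ∀ S T : ℝ≥0, S ≤ T → ∀ t ∈ Icc (0 : ℝ) S, α S t = α T t := by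
    intro S T hST t ht
    have hsub : Icc (0 : ℝ) S ⊆ Icc (0 : ℝ) T := Icc_subset_Icc_right hST
    have key : ∀ R : ℝ≥0, S ≤ R → ∀ s ∈ Ico (0 : ℝ) S,
        HasDerivWithinAt (α R) (drift b p q v (α R s)) (Ici s) s := fun R hR s hs =>
      ((hd R s ⟨hs.1, hs.2.le.trans hR⟩).mono (Icc_subset_Icc_left hs.1)).mono_of_mem_nhdsWithin
        (Icc_mem_nhdsGE (hs.2.trans_le hR))
    exact eq_of_drift h (fun s hs => (hd S s hs).continuousWithinAt)
      (fun s hs => ((hd T s (hsub hs)).continuousWithinAt).mono hsub)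
      (key S le_rfl) (key T hST) ((h0 S).trans (h0 T).symm) ht
  -- The spare unit of time keeps `t` away from the right end of its window, so a two-sided
  -- neighbourhood is available there; `hE` makes the choice of window irrelevant.
  refine ⟨fun t => α (t.toNNReal + 1) t, by simp [h0], fun t ht => ?_, fun t ht => ?_⟩
  · set T : ℝ≥0 := t.toNNReal + 1 with hT
    have hTt : (T : ℝ) = t + 1 := by simp [hT, ht]
    have h1 : HasDerivWithinAt (α T) (drift b p q v (α T t)) (Ici 0) t :=
      (hd T t ⟨ht, by linarith⟩).mono_of_mem_nhdsWithin (by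
        rw [mem_nhdsWithin]
        exact ⟨Iio (T : ℝ), isOpen_Iio, by simp [hTt], fun s hs => ⟨hs.2, hs.1.le⟩⟩)
    refine h1.congr_of_eventuallyEq ?_ rfl
    filter_upwards [self_mem_nhdsWithin, mem_nhdsWithin_of_mem_nhds (Iio_mem_nhds (lt_add_one t))]
      with s hs0 hst
    have hs0' : 0 ≤ s := hs0
    rcases le_total (s.toNNReal + 1) T with hle | hle
    · exact hE _ _ hle s ⟨hs0', by simp [hs0']⟩
    · exact (hE _ _ hle s ⟨hs0', by rw [hTt]; exact (mem_Iio.1 hst).le⟩).symm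
  · exact hm _ t ⟨ht, by simp [ht]⟩

/-- A solution started below `1` stays quantitatively below `1`. -/
theorem IsFlow.one_sub_ge {b p q v w : ℝ} (h : Admissible b p q) (hv : v ≤ 1) {y : ℝ → ℝ}
    (hy : IsFlow b p q v w y) {t : ℝ} (ht : 0 ≤ t) :
    Real.exp (-(b * p * t)) * (1 - w) ≤ 1 - y t := by
  have hd : ∀ s ∈ Icc 0 t, HasDerivWithinAt (fun s => Real.exp (b * p * s) * (1 - y s))
      (Real.exp (b * p * s) * (b * p) * (1 - y s) +
        Real.exp (b * p * s) * (-drift b p q v (y s))) (Ici 0) s := by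
    intro s hs
    have h1 : HasDerivAt (fun s => Real.exp (b * p * s)) (Real.exp (b * p * s) * (b * p)) s := by
      simpa using ((hasDerivAt_id s).const_mul (b * p)).exp
    exact h1.hasDerivWithinAt.mul ((hy.deriv s hs.1).const_sub 1)
  have := le_of_hasDerivWithinAt_nonneg ht hd (fun s hs => by
    have hm := hy.mem s hs.1
    -- The rate `b p` in the exponential cancels the term `-b p (1 - y)` of `(1 - y)'`; what is left
    -- is nonnegative on `[0, 1]`.
    have e : Real.exp (b * p * s) * (b * p) * (1 - y s) +
        Real.exp (b * p * s) * (-drift b p q v (y s)) = Real.exp (b * p * s) * (b *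
          ((p * (1 - v)) + (1 - y s) * (q * y s * (y s + 1)))) := by
      have : p = 1 - q := by linarith [h.add_eq_one]
      unfold drift; rw [this]; ring
    rw [e]
    have h1 : 0 ≤ p * (1 - v) := mul_nonneg h.p_pos.le (by linarith)
    have h2 : 0 ≤ (1 - y s) * (q * y s * (y s + 1)) :=
      mul_nonneg (by linarith [hm.2]) (mul_nonneg (mul_nonneg h.q_pos.le hm.1) (by linarith [hm.1]))
    have := h.b_pos
    positivity)
  simp only [mul_zero, Real.exp_zero, one_mul, hy.init] at this
  calc Real.exp (-(b * p * t)) * (1 - w)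
      ≤ Real.exp (-(b * p * t)) * (Real.exp (b * p * t) * (1 - y t)) := by gcongr
    _ = 1 - y t := by rw [← mul_assoc, ← Real.exp_add]; simp

/-- A solution started below `1` stays below some `r < 1` on compact time intervals. -/
theorem exists_forall_flow_le {b p q v w : ℝ} (h : Admissible b p q) (hv : v ≤ 1) (hw : w < 1)
    (T : ℝ) : ∃ r < 1, ∀ w' ≤ w, ∀ y : ℝ → ℝ, IsFlow b p q v w' y → ∀ t ∈ Icc 0 T, y t ≤ r := by
  refine ⟨1 - Real.exp (-(b * p * T)) * (1 - w), ?_, fun w' hw' y hy t ht => ?_⟩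
  · have := Real.exp_pos (-(b * p * T)); nlinarith
  · have h1 := hy.one_sub_ge h hv ht.1
    have h2 : Real.exp (-(b * p * T)) * (1 - w) ≤ Real.exp (-(b * p * t)) * (1 - w') := by
      have := h.b_pos
      have := h.p_pos
      have := ht.2
      gcongr
    linarith

theorem isFlow_one {b p q : ℝ} (h : Admissible b p q) : IsFlow b p q 1 1 (fun _ => 1) where
  init := rfl
  deriv t _ := by
    have : drift b p q 1 1 = 0 := by
      unfold drift; rw [show p = 1 - q by linarith [h.add_eq_one]]; ring
    rw [this]; exact hasDerivWithinAt_const _ _ _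
  mem _ _ := ⟨zero_le_one, le_rfl⟩

/-- The limit of a solution along the integers is a stationary point. -/
theorem IsFlow.drift_eq_zero {b p q v w L : ℝ} {y : ℝ → ℝ}
    (hy : IsFlow b p q v w y) (hL : Tendsto y atTop (𝓝 L)) : drift b p q v L = 0 := by
  -- Mean value theorem: the drift at `y (c n)` is an increment of a convergent function, hence
  -- tends to `0`.
  have h1 : ∀ n : ℕ, ∃ c ∈ Ioo (n : ℝ) (n + 1), drift b p q v (y c) = y (n + 1) - y n := by
    intro n
    have := exists_hasDerivAt_eq_slope y (fun t => drift b p q v (y t))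
      (lt_add_one (n : ℝ)) (hy.continuousOn.mono fun s hs => n.cast_nonneg.trans hs.1)
      (fun s hs => by
        have hs0 : (0 : ℝ) < s := lt_of_le_of_lt n.cast_nonneg hs.1
        exact (hy.deriv s hs0.le).hasDerivAt (Ici_mem_nhds hs0))
    obtain ⟨c, hc, e⟩ := this
    exact ⟨c, hc, by simpa using e⟩
  choose c hc he using h1
  have hct : Tendsto c atTop atTop :=
    tendsto_atTop_mono (fun n => (hc n).1.le) tendsto_natCast_atTop_atTop
  have h2 : Tendsto (fun n => drift b p q v (y (c n))) atTop (𝓝 (drift b p q v L)) :=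
    (((continuous_drift b p q v).tendsto L).comp hL).comp hct
  have h3 : Tendsto (fun n : ℕ => y (n + 1) - y n) atTop (𝓝 (L - L)) :=
    (hL.comp (tendsto_atTop_add_const_right _ 1 tendsto_natCast_atTop_atTop)).sub
      (hL.comp tendsto_natCast_atTop_atTop)
  simp only [he] at h2
  rw [tendsto_nhds_unique h2 h3, sub_self]

/-! ### The generating function of the transition probabilities -/

/-- The right-hand side of the forward equation at `j`. -/
def forwardTerm (b p q : ℝ) (f : ℕ → ℝ) (j : ℕ) : ℝ :=
  p * b * (j + 1) * f (j + 1) - b * j * f j + q * b * ((j - 2 : ℕ) : ℝ) * f (j - 2)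

theorem tsum_mul_branchingQ (b p q : ℝ) (f : ℕ → ℝ) {j : ℕ} (hj : 1 ≤ j) :
    ∑' k, f k * branchingQ (rates03 b p q) k j = forwardTerm b p q f j := by
  have hsupp : ∀ k ∉ ({j + 1, j, j - 2} : Finset ℕ),
      f k * branchingQ (rates03 b p q) k j = 0 := by
    intro k hk
    simp only [Finset.mem_insert, Finset.mem_singleton, not_or] at hk
    unfold branchingQ rates03
    split_ifs <;> first | omega | simp
  rw [tsum_eq_sum hsupp, Finset.sum_insert (by simp; omega), Finset.sum_insert (by simp; omega),
    Finset.sum_singleton]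
  have h1 : branchingQ (rates03 b p q) (j + 1) j = (j + 1) * (p * b) := by
    simp [branchingQ, rates03]
  have h2 : branchingQ (rates03 b p q) j j = j * (-b) := by
    simp [branchingQ, rates03, hj]
  have h3 : branchingQ (rates03 b p q) (j - 2) j = ((j - 2 : ℕ) : ℝ) * (q * b) := by
    -- For `j ≤ 2` the truncated `j - 2` is the state `0`, which has no outgoing rate.
    rcases Nat.lt_or_ge j 3 with h | h
    · have : j - 2 = 0 := by omega
      simp [branchingQ, this]
    · have : j + 1 - (j - 2) = 3 := by omega
      have h' : 1 ≤ j - 2 ∧ j - 2 ≤ j + 1 := by omega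
      unfold branchingQ
      rw [if_pos h', this]
      simp [rates03]
  rw [h1, h2, h3, forwardTerm]
  ring

/-- The sum telescopes because `∑ j, f j * z ^ j` formally satisfies the transport equation with
speed `drift b p q 1 z`. Only terms at the cutoff `J` survive, together with `-p b f 1`, which is
there because no forward equation is given at `j = 0`. -/
theorem sum_forwardTerm (b p q z : ℝ) (f : ℕ → ℝ) (J : ℕ) :
    ∑ j ∈ Finset.range J, (forwardTerm b p q f (j + 1) * z ^ (j + 1) -
        f (j + 1) * ((j + 1 : ℕ) * z ^ j * drift b p q 1 z)) =
      p * b * ((J + 1) * f (J + 1) * z ^ J - f 1) -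
        q * b * (((J - 1 : ℕ) : ℝ) * f (J - 1) * z ^ (J + 1) + J * f J * z ^ (J + 2)) := by
  induction J with
  | zero => simp
  | succ J ih =>
    rw [Finset.sum_range_succ, ih, forwardTerm, drift, show J + 1 - 2 = J - 1 by omega,
      Nat.add_sub_cancel]
    push_cast
    ring

/-- The bottom term `p b f 1` does not depend on `z`, so it disappears from the difference of two
such sums; the terms at the cutoff are `O(J r ^ J)`. -/
theorem abs_sum_forwardTerm_add_le {b p q z r : ℝ} (h : Admissible b p q) {f : ℕ → ℝ}
    (hf : ∀ j, f j ∈ Icc (0 : ℝ) 1) (hz : 0 ≤ z) (hzr : z ≤ r) (hr : r ≤ 1) (J : ℕ) :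
    |∑ j ∈ Finset.range J, (forwardTerm b p q f (j + 1) * z ^ (j + 1) -
        f (j + 1) * ((j + 1 : ℕ) * z ^ j * drift b p q 1 z)) + p * b * f 1| ≤
      2 * b * (J + 1) * r ^ J := by
  have hb := h.b_pos
  have hp := h.p_pos
  have hq := h.q_pos
  have hz1 : z ≤ 1 := hzr.trans hr
  have hzJ : z ^ J ≤ r ^ J := by gcongr
  have hz0 : 0 ≤ z ^ J := by positivity
  rw [sum_forwardTerm]
  have e : p * b * (((J : ℝ) + 1) * f (J + 1) * z ^ J - f 1) -
        q * b * (((J - 1 : ℕ) : ℝ) * f (J - 1) * z ^ (J + 1) + J * f J * z ^ (J + 2)) +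
        p * b * f 1 = b * z ^ J * (p * ((J + 1) * f (J + 1)) -
          q * (((J - 1 : ℕ) : ℝ) * f (J - 1) * z + J * f J * z ^ 2)) := by ring
  rw [e, abs_mul, abs_of_nonneg (by positivity)]
  have hA0 : 0 ≤ ((J : ℝ) + 1) * f (J + 1) := mul_nonneg (by positivity) (hf _).1
  have hA1 : ((J : ℝ) + 1) * f (J + 1) ≤ J + 1 := mul_le_of_le_one_right (by positivity) (hf _).2
  have hB0 : 0 ≤ ((J - 1 : ℕ) : ℝ) * f (J - 1) * z :=
    mul_nonneg (mul_nonneg (by positivity) (hf _).1) hz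
  have hB1 : ((J - 1 : ℕ) : ℝ) * f (J - 1) * z ≤ J + 1 := by
    have h1 : ((J - 1 : ℕ) : ℝ) ≤ J + 1 := by
      have : J - 1 ≤ J + 1 := by omega
      exact_mod_cast this
    calc ((J - 1 : ℕ) : ℝ) * f (J - 1) * z ≤ ((J - 1 : ℕ) : ℝ) * f (J - 1) :=
          mul_le_of_le_one_right (mul_nonneg (by positivity) (hf _).1) hz1
      _ ≤ ((J - 1 : ℕ) : ℝ) := mul_le_of_le_one_right (by positivity) (hf _).2
      _ ≤ J + 1 := h1
  have hC0 : 0 ≤ (J : ℝ) * f J * z ^ 2 := mul_nonneg (mul_nonneg (by positivity) (hf _).1)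
    (by positivity)
  have hC1 : (J : ℝ) * f J * z ^ 2 ≤ J + 1 := by
    calc (J : ℝ) * f J * z ^ 2 ≤ (J : ℝ) * f J :=
          mul_le_of_le_one_right (mul_nonneg (by positivity) (hf _).1) (pow_le_one₀ hz hz1)
      _ ≤ J := mul_le_of_le_one_right (by positivity) (hf _).2
      _ ≤ J + 1 := by linarith
  have h3 : |p * (((J : ℝ) + 1) * f (J + 1)) -
          q * (((J - 1 : ℕ) : ℝ) * f (J - 1) * z + J * f J * z ^ 2)| ≤ 2 * ((J : ℝ) + 1) := by
    have hp1 : p ≤ 1 := by linarith [h.add_eq_one]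
    have hq1 : q ≤ 1 := by linarith [h.add_eq_one]
    rw [abs_le]
    constructor
    · have := mul_nonneg hp.le hA0
      nlinarith
    · have := mul_nonneg hq.le (add_nonneg hB0 hC0)
      nlinarith
  calc b * z ^ J * |p * (((J : ℝ) + 1) * f (J + 1)) -
          q * (((J - 1 : ℕ) : ℝ) * f (J - 1) * z + J * f J * z ^ 2)| ≤ b * r ^ J * (2 * (J + 1)) := by
        have : 0 ≤ r := hz.trans hzr
        gcongr
    _ = 2 * b * (J + 1) * r ^ J := by ring

section Transition

variable {P : ℝ → ℕ → ℕ → ℝ}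

theorem IsTransitionFunction.mem_Icc (hP : IsTransitionFunction P) {t : ℝ} (ht : 0 ≤ t)
    (i j : ℕ) : P t i j ∈ Icc (0 : ℝ) 1 :=
  ⟨hP.nonneg t ht i j, le_hasSum (hP.honest t ht i) j fun k _ => hP.nonneg t ht i k⟩

theorem IsTransitionFunction.le_one_sub (hP : IsTransitionFunction P) {t : ℝ} (ht : 0 ≤ t)
    {i j : ℕ} (hij : j ≠ i) : P t i j ≤ 1 - P t i i := by
  have := sum_le_hasSum {j, i} (fun k _ => hP.nonneg t ht i k) (hP.honest t ht i)
  rw [Finset.sum_pair hij] at this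
  linarith

theorem IsTransitionFunction.summable_mul_pow (hP : IsTransitionFunction P) {t : ℝ} (ht : 0 ≤ t)
    (i : ℕ) {u : ℝ} (hu : u ∈ Icc (0 : ℝ) 1) : Summable fun j => P t i j * u ^ j :=
  (hP.honest t ht i).summable.of_nonneg_of_le
    (fun j => mul_nonneg (hP.nonneg t ht i j) (pow_nonneg hu.1 j))
    (fun j => mul_le_of_le_one_right (hP.nonneg t ht i j) (pow_le_one₀ hu.1 hu.2))

variable {b p q : ℝ}

theorem ForwardEquation.hasDerivWithinAt (hF : ForwardEquation (rates03 b p q) P) (i : ℕ) {j : ℕ}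
    (hj : 1 ≤ j) {t : ℝ} (ht : 0 ≤ t) :
    HasDerivWithinAt (fun s => P s i j) (forwardTerm b p q (P t i) j) (Ici 0) t := by
  rw [← tsum_mul_branchingQ b p q (P t i) hj]
  exact hF i j hj t ht

/-- The generating function at two points, transported along characteristics. -/
theorem tsum_sub_tsum_eq (h : Admissible b p q) (hP : IsTransitionFunction P)
    (hF : ForwardEquation (rates03 b p q) P) {u₁ u₂ : ℝ} (hu₁ : u₁ < 1) (hu₂ : u₂ < 1)
    {z₁ z₂ : ℝ → ℝ} (hz₁ : IsFlow b p q 1 u₁ z₁) (hz₂ : IsFlow b p q 1 u₂ z₂) {T : ℝ}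
    (hT : 0 ≤ T) (i : ℕ) :
    ∑' j, P T i j * u₁ ^ j - ∑' j, P T i j * u₂ ^ j = z₁ T ^ i - z₂ T ^ i := by
  obtain ⟨r₁, hr₁, H₁⟩ := exists_forall_flow_le h le_rfl hu₁ T
  obtain ⟨r₂, hr₂, H₂⟩ := exists_forall_flow_le h le_rfl hu₂ T
  set r := max r₁ r₂ with hr
  have hr1 : r < 1 := max_lt hr₁ hr₂
  have hb₁ : ∀ t ∈ Icc 0 T, z₁ t ≤ r := fun t ht =>
    (H₁ u₁ le_rfl z₁ hz₁ t ht).trans (le_max_left _ _)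
  have hb₂ : ∀ t ∈ Icc 0 T, z₂ t ≤ r := fun t ht =>
    (H₂ u₂ le_rfl z₂ hz₂ t ht).trans (le_max_right _ _)
  have hr0 : 0 ≤ r := (hz₁.mem 0 le_rfl).1.trans (hb₁ 0 ⟨le_rfl, hT⟩)
  -- As `J → ∞`, `S J T` tends to the left side of the claim and `S J 0` to the right side; along
  -- the backward characteristics the derivative of `S J` is `O(J r ^ J)`. Taking two
  -- characteristics cancels both the unknown evolution at `j = 0` and the term `p b P s i 1`.
  set S : ℕ → ℝ → ℝ := fun J s =>
    ∑ j ∈ Finset.range J, P s i (j + 1) * (z₁ (T - s) ^ (j + 1) - z₂ (T - s) ^ (j + 1)) with hS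
  have hsub : ∀ {u : ℝ} {z : ℝ → ℝ}, IsFlow b p q 1 u z → ∀ s ∈ Icc 0 T,
      HasDerivWithinAt (fun s => z (T - s)) (-drift b p q 1 (z (T - s))) (Icc 0 T) s := by
    intro u z hz s hs
    have h1 := hz.deriv (T - s) (by linarith [hs.2])
    have h2 : HasDerivWithinAt (fun s => T - s) (-1) (Icc 0 T) s :=
      ((hasDerivAt_id s).const_sub T).hasDerivWithinAt
    simpa [Function.comp_def] using
      HasDerivWithinAt.comp s h1 h2 (fun x hx => sub_nonneg.2 hx.2)
  have hder : ∀ J, ∀ s ∈ Icc 0 T, HasDerivWithinAt (S J)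
      ((∑ j ∈ Finset.range J, (forwardTerm b p q (P s i) (j + 1) * z₁ (T - s) ^ (j + 1) -
        P s i (j + 1) * ((j + 1 : ℕ) * z₁ (T - s) ^ j * drift b p q 1 (z₁ (T - s))))) -
      (∑ j ∈ Finset.range J, (forwardTerm b p q (P s i) (j + 1) * z₂ (T - s) ^ (j + 1) -
        P s i (j + 1) * ((j + 1 : ℕ) * z₂ (T - s) ^ j * drift b p q 1 (z₂ (T - s))))))
      (Icc 0 T) s := by
    intro J s hs
    rw [← Finset.sum_sub_distrib]
    refine HasDerivWithinAt.fun_sum fun j _ => ?_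
    have hf := (hF.hasDerivWithinAt i (Nat.le_add_left 1 j) hs.1).mono
      (Icc_subset_Ici_self : Icc 0 T ⊆ Ici 0)
    have h1 := (hsub hz₁ s hs).pow (j + 1)
    have h2 := (hsub hz₂ s hs).pow (j + 1)
    refine (hf.mul (h1.sub h2)).congr_deriv ?_
    simp only [Nat.add_sub_cancel, Pi.sub_apply, Pi.pow_apply]
    ring
  have hbound : ∀ J, |S J T - S J 0| ≤ 4 * b * (J + 1) * r ^ J * T := by
    intro J
    have := norm_image_sub_le_of_norm_deriv_le_segment' (hder J)
      (C := 4 * b * (J + 1) * r ^ J) (fun s hs => ?_) T ⟨hT, le_rfl⟩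
    · simpa using this
    · have hs' : T - s ∈ Icc 0 T := ⟨by linarith [hs.2], by linarith [hs.1]⟩
      have a₁ := abs_sum_forwardTerm_add_le h (hP.mem_Icc hs.1 i) (hz₁.mem _ hs'.1).1
        (hb₁ _ hs') hr1.le J
      have a₂ := abs_sum_forwardTerm_add_le h (hP.mem_Icc hs.1 i) (hz₂.mem _ hs'.1).1
        (hb₂ _ hs') hr1.le J
      rw [Real.norm_eq_abs]
      rw [abs_le] at a₁ a₂ ⊢
      constructor <;> linarith [a₁.1, a₁.2, a₂.1, a₂.2]
  have hu : ∀ {u : ℝ} {z : ℝ → ℝ}, IsFlow b p q 1 u z → u ∈ Icc (0 : ℝ) 1 := fun hz => by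
    have := hz.mem 0 le_rfl
    rwa [hz.init] at this
  have hlim : ∀ s ∈ Icc 0 T, ∀ {x₁ x₂ : ℝ}, x₁ ∈ Icc (0 : ℝ) 1 → x₂ ∈ Icc (0 : ℝ) 1 →
      Tendsto (fun J => ∑ j ∈ Finset.range J, P s i (j + 1) * (x₁ ^ (j + 1) - x₂ ^ (j + 1)))
        atTop (𝓝 (∑' j, P s i j * x₁ ^ j - ∑' j, P s i j * x₂ ^ j)) := by
    intro s hs x₁ x₂ hx₁ hx₂
    have a₁ := (hP.summable_mul_pow hs.1 i hx₁).hasSum.tendsto_sum_nat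
    have a₂ := (hP.summable_mul_pow hs.1 i hx₂).hasSum.tendsto_sum_nat
    refine ((tendsto_add_atTop_iff_nat 1).2 (a₁.sub a₂)).congr fun J => ?_
    rw [← Finset.sum_sub_distrib, Finset.sum_range_succ']
    simp [mul_sub]
  have hzero : ∀ x : ℝ, ∑' j, P 0 i j * x ^ j = x ^ i := by
    intro x
    rw [tsum_eq_single i (fun j hj => by rw [hP.zero, if_neg (Ne.symm hj), zero_mul]), hP.zero]
    simp
  have l₁ : Tendsto (fun J => S J T) atTop
      (𝓝 (∑' j, P T i j * u₁ ^ j - ∑' j, P T i j * u₂ ^ j)) := by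
    have := hlim T ⟨hT, le_rfl⟩ (hu hz₁) (hu hz₂)
    simpa only [hS, sub_self, hz₁.init, hz₂.init] using this
  have l₀ : Tendsto (fun J => S J 0) atTop (𝓝 (z₁ T ^ i - z₂ T ^ i)) := by
    have := hlim 0 ⟨le_rfl, hT⟩ (hz₁.mem T hT) (hz₂.mem T hT)
    simpa only [hS, sub_zero, hzero] using this
  have l₂ : Tendsto (fun J : ℕ => 4 * b * (J + 1) * r ^ J * T) atTop (𝓝 0) := by
    have a₁ := tendsto_self_mul_const_pow_of_lt_one hr0 hr1
    have a₂ := tendsto_pow_atTop_nhds_zero_of_lt_one hr0 hr1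
    have := ((a₁.add a₂).const_mul (4 * b * T))
    simp only [add_zero, mul_zero] at this
    refine this.congr fun J => by ring
  have l₃ := squeeze_zero_norm (f := fun J => S J T - S J 0) hbound l₂
  exact sub_eq_zero.1 (tendsto_nhds_unique (l₁.sub l₀) l₃)

/-- The branching property: the generating function is `Ψ ^ i` for the flow `Ψ` with `v = 1`. -/
theorem hasSum_transition_mul_pow (h : Admissible b p q) (hP : IsTransitionFunction P)
    (hF : ForwardEquation (rates03 b p q) P) {u : ℝ} (hu : u < 1)
    {z : ℝ → ℝ} (hz : IsFlow b p q 1 u z) {T : ℝ} (hT : 0 ≤ T) (i : ℕ) :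
    HasSum (fun j => P T i j * u ^ j) (z T ^ i) := by
  have hu0 : u ∈ Icc (0 : ℝ) 1 := by
    have := hz.mem 0 le_rfl
    rwa [hz.init] at this
  -- Only differences are known so far. At the limit point `1` both sides equal `1`, by honesty and
  -- by the constant flow, and this fixes the constant.
  set w : ℕ → ℝ := fun n => 1 - 1 / ((n : ℝ) + 1) with hw
  have hpos : ∀ n : ℕ, 0 < 1 / ((n : ℝ) + 1) := fun n => by positivity
  have hle : ∀ n : ℕ, 1 / ((n : ℝ) + 1) ≤ 1 := fun n => by
    rw [div_le_one (by positivity)]; linarith [n.cast_nonneg (α := ℝ)]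
  have hw0 : ∀ n, w n ∈ Icc (0 : ℝ) 1 := fun n =>
    ⟨by simp only [hw]; linarith [hle n], by simp only [hw]; linarith [hpos n]⟩
  have hw1 : Tendsto w atTop (𝓝 1) := by
    simpa [hw] using (tendsto_one_div_add_atTop_nhds_zero_nat (𝕜 := ℝ)).const_sub 1
  choose y hy using fun n => exists_isFlow h (right_mem_Icc.2 zero_le_one) (hw0 n)
  have e : ∀ n, ∑' j, P T i j * u ^ j - ∑' j, P T i j * w n ^ j = z T ^ i - y n T ^ i := fun n =>
    tsum_sub_tsum_eq h hP hF hu (by simp only [hw]; linarith [hpos n]) hz (hy n) hT i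
  have l₁ : Tendsto (fun n => ∑' j, P T i j * w n ^ j) atTop (𝓝 (∑' j, P T i j)) := by
    refine tendsto_tsum_of_dominated_convergence (hP.honest T hT i).summable (fun j => ?_)
      (Eventually.of_forall fun n j => ?_)
    · simpa using (hw1.pow j).const_mul (P T i j)
    · rw [norm_mul, Real.norm_of_nonneg (hP.nonneg T hT i j), norm_pow,
        Real.norm_of_nonneg (hw0 n).1]
      exact mul_le_of_le_one_right (hP.nonneg T hT i j) (pow_le_one₀ (hw0 n).1 (hw0 n).2)
  have l₂ : Tendsto (fun n => y n T) atTop (𝓝 1) := by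
    rw [tendsto_iff_norm_sub_tendsto_zero]
    refine squeeze_zero (fun _ => norm_nonneg _)
      (fun n => (hy n).dist_le h (isFlow_one h) hT) ?_
    have := ((hw1.sub_const 1).abs).mul_const (Real.exp (b * 4 * T))
    simpa using this
  rw [(hP.honest T hT i).tsum_eq] at l₁
  have := tendsto_nhds_unique ((tendsto_const_nhds.sub l₁).congr e)
    (tendsto_const_nhds.sub (l₂.pow i))
  rw [one_pow] at this
  have e' : ∑' j, P T i j * u ^ j = z T ^ i := by linarith
  exact e' ▸ (hP.summable_mul_pow hT i hu0).hasSum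

theorem transition_zero_eq (h : Admissible b p q) (hP : IsTransitionFunction P)
    (hF : ForwardEquation (rates03 b p q) P) {z : ℝ → ℝ} (hz : IsFlow b p q 1 0 z) {T : ℝ}
    (hT : 0 ≤ T) (i : ℕ) : P T i 0 = z T ^ i := by
  have h1 := hasSum_transition_mul_pow h hP hF zero_lt_one hz hT i
  have h2 := hasSum_single (f := fun j => P T i j * (0 : ℝ) ^ j) 0
    (fun j hj => by simp [zero_pow hj])
  simpa using h2.unique h1

/-- The forward equation is silent at `j = 0`; that `0` is absorbing comes out of the branching
property with exponent `0`. -/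
theorem transition_zero_zero (h : Admissible b p q) (hP : IsTransitionFunction P)
    (hF : ForwardEquation (rates03 b p q) P) {T : ℝ} (hT : 0 ≤ T) : P T 0 0 = 1 := by
  obtain ⟨z, hz⟩ := exists_isFlow (v := 1) (w := 0) h (by simp) (by simp)
  simpa using transition_zero_eq h hP hF hz hT 0

/-- Dropping the nonnegative inflow in the forward equation leaves a derivative of at least `-b i`.
-/
theorem one_sub_transition_self_le (h : Admissible b p q) (hP : IsTransitionFunction P)
    (hF : ForwardEquation (rates03 b p q) P) {t : ℝ} (ht : 0 ≤ t) {i : ℕ} (hi : 1 ≤ i) :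
    1 - P t i i ≤ b * i * t := by
  have hb := h.b_pos
  have := le_of_hasDerivWithinAt_nonneg (f := fun s => P s i i + b * i * s)
    (f' := fun s => forwardTerm b p q (P s i) i + b * i) ht
    (fun s hs => (hF.hasDerivWithinAt i hi hs.1).add
      (by simpa using ((hasDerivAt_id s).const_mul (b * i)).hasDerivWithinAt))
    (fun s hs => by
      have h1 := hP.mem_Icc hs.1 i i
      have h2 : 0 ≤ p * b * (i + 1) * P s i (i + 1) :=
        mul_nonneg (by have := h.p_pos; positivity) (hP.nonneg s hs.1 _ _)
      have h3 : 0 ≤ q * b * ((i - 2 : ℕ) : ℝ) * P s i (i - 2) :=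
        mul_nonneg (by have := h.q_pos; positivity) (hP.nonneg s hs.1 _ _)
      have h4 : b * i * P s i i ≤ b * i := mul_le_of_le_one_right (by positivity) h1.2
      unfold forwardTerm
      linarith)
  simp only [hP.zero, if_true, mul_zero, add_zero] at this
  linarith

/-- The derivative of the one-step-down probability is `p b i` up to `O(i² t)`. -/
theorem exists_hasDerivWithinAt_down (h : Admissible b p q) (hP : IsTransitionFunction P)
    (hF : ForwardEquation (rates03 b p q) P) {t : ℝ} (ht : 0 ≤ t) (i : ℕ) :
    ∃ d, HasDerivWithinAt (fun s => P s (i + 1) i) d (Ici 0) t ∧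
      |d - p * b * (i + 1)| ≤ 2 * b ^ 2 * (i + 1) ^ 2 * t := by
  have hb := h.b_pos
  have hp := h.p_pos
  have hq := h.q_pos
  have hself := one_sub_transition_self_le h hP hF ht (Nat.le_add_left 1 i)
  push_cast at hself
  -- The target `0` has no forward equation; there `P s 1 0` is the flow started at `0`.
  rcases Nat.eq_zero_or_pos i with rfl | hi
  · obtain ⟨z, hz⟩ := exists_isFlow (v := 1) (w := 0) h (by simp) (by simp)
    have e : ∀ s ∈ Ici (0 : ℝ), P s (0 + 1) 0 = z s := fun s hs => by
      simpa using transition_zero_eq h hP hF hz hs 1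
    refine ⟨_, (hz.deriv t ht).congr e (e t ht), ?_⟩
    have hle : z t ≤ b * t := by
      rw [← e t ht]
      exact (hP.le_one_sub ht (by norm_num)).trans (by simpa using hself)
    have hm := hz.mem t ht
    have h3 : 0 ≤ q * z t ^ 3 := mul_nonneg hq.le (pow_nonneg hm.1 3)
    have h3' : q * z t ^ 3 ≤ z t := by
      have h1 : z t ^ 3 ≤ z t ^ 1 := pow_le_pow_of_le_one hm.1 hm.2 (by norm_num)
      have : q ≤ 1 := by linarith [h.add_eq_one]
      calc q * z t ^ 3 ≤ 1 * z t ^ 1 := by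
            apply mul_le_mul this h1 (pow_nonneg hm.1 3) zero_le_one
        _ = z t := by ring
    have e2 : drift b p q 1 (z t) - p * b * (((0 : ℕ) : ℝ) + 1) = -(b * (z t - q * z t ^ 3)) := by
      unfold drift; push_cast; ring
    rw [e2, abs_neg, abs_of_nonneg (mul_nonneg hb.le (by linarith))]
    calc b * (z t - q * z t ^ 3) ≤ b * (b * t) := by gcongr; linarith
      _ ≤ 2 * b ^ 2 * (((0 : ℕ) : ℝ) + 1) ^ 2 * t := by push_cast; nlinarith [mul_nonneg (sq_nonneg b) ht]
  · refine ⟨_, hF.hasDerivWithinAt (i + 1) hi ht, ?_⟩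
    set f := P t (i + 1) with hf
    -- Every state other than the starting point `i + 1` carries at most the mass that has left it.
    have h1 : f i ≤ b * (i + 1) * t := (hP.le_one_sub ht (by omega)).trans hself
    have h2 : f (i - 2) ≤ b * (i + 1) * t := (hP.le_one_sub ht (by omega)).trans hself
    have h1' : 0 ≤ f i := hP.nonneg t ht _ _
    have h2' : 0 ≤ f (i - 2) := hP.nonneg t ht _ _
    have h3' : f (i + 1) ≤ 1 := (hP.mem_Icc ht _ _).2
    have hi2 : ((i - 2 : ℕ) : ℝ) ≤ i + 1 := by
      have : i - 2 ≤ i + 1 := by omega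
      exact_mod_cast this
    set c : ℝ := b * (i + 1) * t with hc
    have hc0 : 0 ≤ c := by positivity
    have e : forwardTerm b p q f i - p * b * (i + 1) =
        -(p * b * (i + 1) * (1 - f (i + 1))) - b * i * f i
          + q * b * ((i - 2 : ℕ) : ℝ) * f (i - 2) := by
      unfold forwardTerm; ring
    have A : p * b * (i + 1) * (1 - f (i + 1)) ≤ p * b * (i + 1) * c := by gcongr
    have A0 : 0 ≤ p * b * (i + 1) * (1 - f (i + 1)) := mul_nonneg (by positivity) (by linarith)
    have B : b * i * f i ≤ b * (i + 1) * c := by gcongr; linarith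
    have B0 : 0 ≤ b * i * f i := by positivity
    have C : q * b * ((i - 2 : ℕ) : ℝ) * f (i - 2) ≤ q * b * (i + 1) * c := by gcongr
    have C0 : 0 ≤ q * b * ((i - 2 : ℕ) : ℝ) * f (i - 2) := by positivity
    have hsum : p * b * (i + 1) * c + q * b * (i + 1) * c = b * (i + 1) * c := by
      rw [← add_mul, ← add_mul, ← add_mul, h.add_eq_one, one_mul]
    have hp' : 0 ≤ p * b * (i + 1) * c := by positivity
    have hq' : 0 ≤ q * b * (i + 1) * c := by positivity
    have e2 : 2 * b ^ 2 * ((i : ℝ) + 1) ^ 2 * t = 2 * (b * (i + 1) * c) := by rw [hc]; ring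
    rw [e, e2, abs_le]
    constructor <;> linarith

end Transition

/-! ### The transition operator weighted by deaths, over a short time -/

/-- One-step errors grow like `i² r ^ (i - 1)`. This bound makes them uniform in the state, and it
is the reason for working with `w < 1`. -/
theorem exists_sq_mul_pow_le {r : ℝ} (hr0 : 0 ≤ r) (hr : r < 1) :
    ∃ C : ℝ, 0 ≤ C ∧ ∀ i : ℕ, ((i : ℝ) + 1) ^ 2 * r ^ (i - 1) ≤ C := by
  have h1 : Tendsto (fun n : ℕ => ((n : ℝ) + 2) ^ 2 * r ^ n) atTop (𝓝 0) := by
    have a := tendsto_pow_const_mul_const_pow_of_lt_one 2 hr0 hr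
    have b := tendsto_self_mul_const_pow_of_lt_one hr0 hr
    have c := tendsto_pow_atTop_nhds_zero_of_lt_one hr0 hr
    have := (a.add (b.const_mul 4)).add (c.const_mul 4)
    simp only [add_zero, mul_zero] at this
    refine this.congr fun n => by ring
  obtain ⟨C, hC⟩ := h1.bddAbove_range
  refine ⟨max C 1, by positivity, fun i => ?_⟩
  rcases i with _ | i
  · simp
  · refine le_trans ?_ (le_max_left _ _)
    have := hC (mem_range_self i)
    simp only [Nat.add_sub_cancel]
    push_cast
    convert this using 2
    ring

theorem IsFlow.abs_sub_le {b p q v w : ℝ} (h : Admissible b p q) (hv : v ∈ Icc (0 : ℝ) 1)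
    {y : ℝ → ℝ} (hy : IsFlow b p q v w y) {t : ℝ} (ht : 0 ≤ t) : |y t - w| ≤ b * t := by
  have := norm_image_sub_le_of_norm_deriv_le_segment' (f := y) (a := 0) (b := t) (C := b)
    (fun s hs => (hy.deriv s hs.1).mono Icc_subset_Ici_self)
    (fun s hs => abs_drift_le h hv (hy.mem s hs.1)) t ⟨ht, le_rfl⟩
  simpa [hy.init] using this

theorem abs_pow_sub_pow_le_of_le {x y r : ℝ} (hx : 0 ≤ x) (hxr : x ≤ r) (hy : 0 ≤ y) (hyr : y ≤ r)
    (i : ℕ) : |x ^ i - y ^ i| ≤ |x - y| * i * r ^ (i - 1) := by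
  refine (abs_pow_sub_pow_le x y i).trans ?_
  have : max |x| |y| ≤ r := by rw [abs_of_nonneg hx, abs_of_nonneg hy]; exact max_le hxr hyr
  gcongr

section Transition

variable {P : ℝ → ℕ → ℕ → ℝ} {b p q : ℝ}

/-- The sum defining the transition operator weighted by `v` at each jump `i + 1 → i`. -/
theorem hasSum_weighted_succ (h : Admissible b p q) (hP : IsTransitionFunction P)
    (hF : ForwardEquation (rates03 b p q) P) (v : ℝ) {u : ℝ} (hu : u < 1)
    {z : ℝ → ℝ} (hz : IsFlow b p q 1 u z) {t : ℝ} (ht : 0 ≤ t) (i : ℕ) :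
    HasSum (fun j => P t (i + 1) j * ((if j + 1 = i + 1 then v else 1) * u ^ j))
      (z t ^ (i + 1) - (1 - v) * P t (i + 1) i * u ^ i) := by
  have h1 := hasSum_transition_mul_pow h hP hF hu hz ht (i + 1)
  have h2 := hasSum_ite_eq i ((1 - v) * P t (i + 1) i * u ^ i)
  refine (h1.sub h2).congr_fun fun j => ?_
  by_cases hj : j = i
  · subst hj; simp; ring
  · simp [hj]

theorem hasSum_weighted_zero (h : Admissible b p q) (hP : IsTransitionFunction P)
    (hF : ForwardEquation (rates03 b p q) P) (v : ℝ) {u : ℝ} (hu : u < 1)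
    {z : ℝ → ℝ} (hz : IsFlow b p q 1 u z) {t : ℝ} (ht : 0 ≤ t) :
    HasSum (fun j => P t 0 j * ((if j + 1 = 0 then v else 1) * u ^ j)) 1 := by
  simpa using hasSum_transition_mul_pow h hP hF hu hz ht 0

/-- The difference vanishes at time `0` and its derivative at time `s` is `O(s)`, so it is `O(t²)`.
-/
theorem abs_weighted_sub_pow_le (h : Admissible b p q) (hP : IsTransitionFunction P)
    (hF : ForwardEquation (rates03 b p q) P) {v : ℝ} (hv : v ∈ Icc (0 : ℝ) 1) {u r C : ℝ}
    {z y : ℝ → ℝ} (hz : IsFlow b p q 1 u z) (hy : IsFlow b p q v u y) {t : ℝ} (ht : 0 ≤ t)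
    (hzr : ∀ s ∈ Icc 0 t, z s ≤ r) (hyr : ∀ s ∈ Icc 0 t, y s ≤ r) (hr : r ≤ 1)
    (hC : ∀ i : ℕ, ((i : ℝ) + 1) ^ 2 * r ^ (i - 1) ≤ C) (i : ℕ) :
    |z t ^ (i + 1) - (1 - v) * P t (i + 1) i * u ^ i - y t ^ (i + 1)| ≤ 13 * b ^ 2 * C * t ^ 2 := by
  have hb := h.b_pos
  have hp := h.p_pos
  have hp1 : p ≤ 1 := by linarith [h.q_pos, h.add_eq_one]
  have hu0 : 0 ≤ u := by have := (hy.mem 0 le_rfl).1; rwa [hy.init] at this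
  have hur : u ≤ r := by have := hyr 0 ⟨le_rfl, ht⟩; rwa [hy.init] at this
  have hr0 : 0 ≤ r := hu0.trans hur
  have hv1 : 0 ≤ 1 - v := by linarith [hv.2]
  have hv1' : 1 - v ≤ 1 := by linarith [hv.1]
  have hC0 : 0 ≤ C := le_trans (by positivity) (hC 0)
  have hCi : ((i : ℝ) + 1) * i * r ^ (i - 1) ≤ C := by
    refine le_trans ?_ (hC i)
    gcongr
    nlinarith [i.cast_nonneg (α := ℝ)]
  have hri : r ^ i ≤ r ^ (i - 1) := pow_le_pow_of_le_one hr0 hr (by omega)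
  have hCi' : ((i : ℝ) + 1) ^ 2 * r ^ i ≤ C := le_trans (by gcongr) (hC i)
  have hCi'' : ((i : ℝ) + 1) * r ^ i ≤ C := by
    refine le_trans ?_ hCi'
    gcongr
    nlinarith [i.cast_nonneg (α := ℝ)]
  choose! d hd hdb using fun s (hs : 0 ≤ s) => exists_hasDerivWithinAt_down h hP hF hs i
  have hder : ∀ s ∈ Icc 0 t, HasDerivWithinAt
      (fun s => z s ^ (i + 1) - (1 - v) * P s (i + 1) i * u ^ i - y s ^ (i + 1))
      ((i + 1) * (z s ^ i * drift b p q 1 (z s)) - (1 - v) * d s * u ^ i -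
        (i + 1) * (y s ^ i * drift b p q v (y s))) (Icc 0 t) s := by
    intro s hs
    have h1 := (hz.deriv s hs.1).fun_pow (i + 1)
    have h2 := (hy.deriv s hs.1).fun_pow (i + 1)
    have h3 := ((hd s hs.1).const_mul (1 - v)).mul_const (u ^ i)
    refine (((h1.sub h3).sub h2).mono Icc_subset_Ici_self).congr_deriv ?_
    simp only [Nat.add_sub_cancel]
    push_cast
    ring
  have hbound : ∀ s ∈ Ico 0 t, ‖((i : ℝ) + 1) * (z s ^ i * drift b p q 1 (z s)) -
      (1 - v) * d s * u ^ i - (i + 1) * (y s ^ i * drift b p q v (y s))‖ ≤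
        13 * b ^ 2 * C * t := by
    intro s hs
    have hs' := Ico_subset_Icc_self hs
    have hs0 : 0 ≤ s := hs.1
    have hzm := hz.mem s hs.1
    have hym := hy.mem s hs.1
    have hzu := hz.abs_sub_le h ⟨zero_le_one, le_rfl⟩ hs.1
    have hyu := hy.abs_sub_le h hv hs.1
    have hzy : |z s - y s| ≤ 2 * b * s := by
      rw [abs_le] at hzu hyu ⊢
      constructor <;> linarith [hzu.1, hzu.2, hyu.1, hyu.2]
    -- The two drifts differ by `b p (1 - v)`, which is what the correction removes to first order,
    -- as `d s ≈ p b (i + 1)`. The four groups contribute `2 + 8 + 1 + 2 = 13` times `b ^ 2 * C *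
    -- s`.
    have e : ((i : ℝ) + 1) * (z s ^ i * drift b p q 1 (z s)) -
      (1 - v) * d s * u ^ i - (i + 1) * (y s ^ i * drift b p q v (y s)) =
        ((i + 1) * ((z s ^ i - y s ^ i) * drift b p q 1 (z s)) +
          (i + 1) * (y s ^ i * (drift b p q 1 (z s) - drift b p q 1 (y s)))) +
        ((1 - v) * ((i + 1) * (b * p) * (y s ^ i - u ^ i)) -
          (1 - v) * ((d s - p * b * (i + 1)) * u ^ i)) := by
      unfold drift; ring
    have A : |((i : ℝ) + 1) * ((z s ^ i - y s ^ i) * drift b p q 1 (z s))| ≤ 2 * b ^ 2 * C * s := by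
      rw [abs_mul, abs_mul, abs_of_nonneg (by positivity)]
      calc ((i : ℝ) + 1) * (|z s ^ i - y s ^ i| * |drift b p q 1 (z s)|)
          ≤ ((i : ℝ) + 1) * ((2 * b * s * i * r ^ (i - 1)) * b) := by
            gcongr
            · exact (abs_pow_sub_pow_le_of_le hzm.1 (hzr s hs') hym.1 (hyr s hs') i).trans
                (by gcongr)
            · exact abs_drift_le h ⟨zero_le_one, le_rfl⟩ hzm
        _ = 2 * b ^ 2 * (((i : ℝ) + 1) * i * r ^ (i - 1)) * s := by ring
        _ ≤ 2 * b ^ 2 * C * s := by have := hs.1; gcongr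
    have B : |((i : ℝ) + 1) * (y s ^ i * (drift b p q 1 (z s) - drift b p q 1 (y s)))| ≤
        8 * b ^ 2 * C * s := by
      rw [abs_mul, abs_mul, abs_of_nonneg (show (0 : ℝ) ≤ (i : ℝ) + 1 by positivity),
        abs_of_nonneg (pow_nonneg hym.1 i)]
      have hl := abs_drift_sub_le (v := 1) h le_rfl (abs_le.2 ⟨by linarith [hzm.1], hzm.2⟩)
        (abs_le.2 ⟨by linarith [hym.1], hym.2⟩)
      calc ((i : ℝ) + 1) * (y s ^ i * |drift b p q 1 (z s) - drift b p q 1 (y s)|)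
          ≤ ((i : ℝ) + 1) * (r ^ i * (b * (4 * 1 ^ 2) * (2 * b * s))) := by
            have := hym.1
            have := hyr s hs'
            gcongr
            exact hl.trans (by gcongr)
        _ = 8 * b ^ 2 * (((i : ℝ) + 1) * r ^ i) * s := by ring
        _ ≤ 8 * b ^ 2 * C * s := by have := hs.1; gcongr
    have D : |(1 - v) * (((i : ℝ) + 1) * (b * p) * (y s ^ i - u ^ i))| ≤ b ^ 2 * C * s := by
      rw [abs_mul, abs_mul, abs_of_nonneg hv1,
        abs_of_nonneg (show (0 : ℝ) ≤ ((i : ℝ) + 1) * (b * p) by positivity)]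
      calc (1 - v) * (((i : ℝ) + 1) * (b * p) * |y s ^ i - u ^ i|)
          ≤ 1 * (((i : ℝ) + 1) * (b * 1) * (b * s * i * r ^ (i - 1))) := by
            gcongr
            exact (abs_pow_sub_pow_le_of_le hym.1 (hyr s hs') hu0 hur i).trans (by gcongr)
        _ = b ^ 2 * (((i : ℝ) + 1) * i * r ^ (i - 1)) * s := by ring
        _ ≤ b ^ 2 * C * s := by have := hs.1; gcongr
    have E : |(1 - v) * ((d s - p * b * (i + 1)) * u ^ i)| ≤ 2 * b ^ 2 * C * s := by
      rw [abs_mul, abs_mul, abs_of_nonneg hv1, abs_of_nonneg (pow_nonneg hu0 i)]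
      calc (1 - v) * (|d s - p * b * (i + 1)| * u ^ i)
          ≤ 1 * ((2 * b ^ 2 * (i + 1) ^ 2 * s) * r ^ i) := by
            gcongr
            exact hdb s hs.1
        _ = 2 * b ^ 2 * (((i : ℝ) + 1) ^ 2 * r ^ i) * s := by ring
        _ ≤ 2 * b ^ 2 * C * s := by have := hs.1; gcongr
    rw [e, Real.norm_eq_abs]
    have hst : 13 * b ^ 2 * C * s ≤ 13 * b ^ 2 * C * t := by
      have := hs.2.le
      gcongr
    refine le_trans ?_ hst
    refine (abs_add_le _ _).trans ?_
    have h1 := abs_add_le (((i : ℝ) + 1) * ((z s ^ i - y s ^ i) * drift b p q 1 (z s)))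
      (((i : ℝ) + 1) * (y s ^ i * (drift b p q 1 (z s) - drift b p q 1 (y s))))
    have h2 := abs_sub ((1 - v) * (((i : ℝ) + 1) * (b * p) * (y s ^ i - u ^ i)))
      ((1 - v) * ((d s - p * b * (i + 1)) * u ^ i))
    linarith
  have := norm_image_sub_le_of_norm_deriv_le_segment' hder hbound t ⟨ht, le_rfl⟩
  have h0 : P 0 (i + 1) i = 0 := by rw [hP.zero, if_neg (by omega)]
  rw [Real.norm_eq_abs, hz.init, hy.init, h0] at this
  calc _ = _ := by congr 1; ring
    _ ≤ _ := this
    _ = _ := by ring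

/-- Consistency of the weighted transition operator with the flow `y`: over a time step `h` the
error is `O(h²)`, uniformly in the state. -/
theorem exists_abs_weighted_sub_le (h : Admissible b p q) (hP : IsTransitionFunction P)
    (hF : ForwardEquation (rates03 b p q) P) {v : ℝ} (hv : v ∈ Icc (0 : ℝ) 1) {w : ℝ} (hw : w < 1)
    {y : ℝ → ℝ} (hy : IsFlow b p q v w y) (T : ℝ) :
    ∃ C : ℝ, 0 ≤ C ∧ ∀ s t : ℝ, 0 ≤ s → 0 ≤ t → s + t ≤ T → ∀ i : ℕ, ∃ K : ℝ,
      HasSum (fun j => P t i j * ((if j + 1 = i then v else 1) * y s ^ j)) K ∧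
      |K - y (s + t) ^ i| ≤ C * t ^ 2 := by
  obtain ⟨r₁, hr₁, H₁⟩ := exists_forall_flow_le h hv.2 hw T
  -- The auxiliary flow with `v = 1` starts at `y s ≤ r₁`, so it needs its own bound below `1`.
  obtain ⟨r₂, hr₂, H₂⟩ := exists_forall_flow_le h le_rfl hr₁ T
  have hr : max 0 (max r₁ r₂) < 1 := max_lt zero_lt_one (max_lt hr₁ hr₂)
  obtain ⟨C, hC0, hC⟩ := exists_sq_mul_pow_le (le_max_left _ _) hr
  refine ⟨13 * b ^ 2 * C, by positivity, fun s t hs ht hst i => ?_⟩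
  have hys : y s ≤ r₁ := H₁ w le_rfl y hy s ⟨hs, by linarith⟩
  obtain ⟨z, hz⟩ := exists_isFlow h (right_mem_Icc.2 zero_le_one) (hy.mem s hs)
  rcases i with _ | i
  · refine ⟨1, hasSum_weighted_zero h hP hF v (hys.trans_lt hr₁) hz ht, ?_⟩
    simp; positivity
  · refine ⟨_, hasSum_weighted_succ h hP hF v (hys.trans_lt hr₁) hz ht i, ?_⟩
    refine abs_weighted_sub_pow_le h hP hF hv hz (hy.shift hs) ht (fun x hx => ?_)
      (fun x hx => ?_) hr.le hC i
    · exact (H₂ _ hys z hz x ⟨hx.1, by linarith [hx.2]⟩).trans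
        ((le_max_right _ _).trans (le_max_right _ _))
    · exact (H₁ w le_rfl y hy (s + x) ⟨by linarith [hx.1], by linarith [hx.2]⟩).trans
        ((le_max_left _ _).trans (le_max_right _ _))

end Transition

/-! ### Counting deaths along a partition -/

/-- The number of indices `k < N` such that `x` drops by exactly one between `k h` and
`(k + 1) h`. -/
def stepDeaths (x : ℝ≥0 → ℕ) (h : ℝ≥0) (N : ℕ) : ℕ :=
  ∑ k ∈ Finset.range N, if x ((k + 1 : ℕ) * h) + 1 = x (k * h) then 1 else 0

/-- In a discrete space one-sided limits are attained, so near `a` the path can jump only at `a`. -/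
theorem IsCadlagPath.exists_piecewise {x : ℝ≥0 → ℕ} (hx : IsCadlagPath x) (a : ℝ≥0) :
    ∃ l, ∀ᶠ r in 𝓝 a, (r < a → x r = l) ∧ (a ≤ r → x r = x a) := by
  obtain ⟨hr, l, hl⟩ := hx a
  have hl' : ∀ᶠ r in 𝓝[<] a, x r = l := by simpa [nhds_discrete] using hl
  have hr' : ∀ᶠ r in 𝓝[≥] a, x r = x a := by
    simpa [ContinuousWithinAt, nhds_discrete] using hr
  rw [eventually_nhdsWithin_iff] at hl' hr'
  exact ⟨l, hl'.and hr'⟩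

theorem deathTimes_mono (x : ℝ≥0 → ℕ) {s t : ℝ≥0} (hst : s ≤ t) :
    deathTimes x s ⊆ deathTimes x t := fun _ hc => ⟨hc.1, hc.2.1.trans hst, hc.2.2⟩

theorem deathTimes_zero (x : ℝ≥0 → ℕ) : deathTimes x 0 = ∅ := by
  ext c
  simp only [deathTimes, mem_ofPred_eq, mem_empty_iff_false, iff_false]
  rintro ⟨h1, h2, -⟩
  exact absurd h1 (not_lt.2 h2)

theorem not_eventually_of_const {x : ℝ≥0 → ℕ} {c : ℝ≥0} (hc : 0 < c)
    (h : ∀ᶠ r in 𝓝[<] c, x r = x c) : ¬ ∀ᶠ r in 𝓝[<] c, x r = x c + 1 := by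
  intro h'
  have : (𝓝[<] c).NeBot := nhdsLT_neBot_of_exists_lt ⟨0, hc⟩
  obtain ⟨r, h1, h2⟩ := (h.and h').exists
  omega

/-- On an interval where the path has at most one jump, deaths are seen at the end points. -/
theorem ncard_deathTimes_step {x : ℝ≥0 → ℕ} (hx : IsCadlagPath x) {s s' a : ℝ≥0} {l : ℕ}
    (hs : s ≤ s') (h : ∀ r ∈ Icc s s', (r < a → x r = l) ∧ (a ≤ r → x r = x a)) :
    (deathTimes x s').ncard =
      (deathTimes x s).ncard + if x s' + 1 = x s then 1 else 0 := by
  set D : Set ℝ≥0 := {c | s < c ∧ c ≤ s' ∧ ∀ᶠ r in 𝓝[<] c, x r = x c + 1} with hD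
  have hunion : deathTimes x s' = deathTimes x s ∪ D := by
    ext c
    simp only [deathTimes, hD, mem_union, mem_ofPred_eq]
    constructor
    · rintro ⟨h1, h2, h3⟩
      rcases le_or_gt c s with hc | hc
      · exact Or.inl ⟨h1, hc, h3⟩
      · exact Or.inr ⟨hc, h2, h3⟩
    · rintro (⟨h1, h2, h3⟩ | ⟨h1, h2, h3⟩)
      · exact ⟨h1, h2.trans hs, h3⟩
      · exact ⟨zero_le.trans_lt h1, h2, h3⟩
  have hdisj : Disjoint (deathTimes x s) D :=
    Set.disjoint_left.2 fun c h1 h2 => absurd h2.1 (not_lt.2 h1.2.1)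
  have hDfin : D.Finite := (deathTimes_finite hx s').subset (by rw [hunion]; simp)
  rw [hunion, ncard_union_eq hdisj (deathTimes_finite hx s) hDfin, Nat.add_left_cancel_iff]
  have hmem : ∀ c ∈ D, c = a := by
    rintro c ⟨h1, h2, h3⟩
    by_contra hne
    refine not_eventually_of_const (zero_le.trans_lt h1) ?_ h3
    have hIoo : ∀ᶠ r in 𝓝[<] c, r ∈ Ioo s c := Ioo_mem_nhdsLT h1
    rcases lt_or_gt_of_ne hne with hlt | hgt
    · filter_upwards [hIoo] with r hr
      rw [(h r ⟨hr.1.le, hr.2.le.trans h2⟩).1 (hr.2.trans hlt), (h c ⟨h1.le, h2⟩).1 hlt]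
    · filter_upwards [hIoo, Ioo_mem_nhdsLT hgt] with r hr hr'
      rw [(h r ⟨hr.1.le, hr.2.le.trans h2⟩).2 hr'.1.le, (h c ⟨h1.le, h2⟩).2 hgt.le]
  by_cases ha : s < a ∧ a ≤ s'
  · have h1 : x s = l := (h s ⟨le_rfl, hs⟩).1 ha.1
    have h2 : x s' = x a := (h s' ⟨hs, le_rfl⟩).2 ha.2
    have hev : ∀ᶠ r in 𝓝[<] a, x r = l := by
      filter_upwards [Ioo_mem_nhdsLT ha.1] with r hr
      exact (h r ⟨hr.1.le, hr.2.le.trans ha.2⟩).1 hr.2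
    rw [h1, h2]
    split_ifs with hl
    · have : D = {a} := by
        refine Subset.antisymm hmem ?_
        rintro _ rfl
        exact ⟨ha.1, ha.2, hl ▸ hev⟩
      rw [this, ncard_singleton]
    · have : D = ∅ := by
        refine eq_empty_of_forall_notMem fun c hc => hl ?_
        obtain rfl := hmem c hc
        have : (𝓝[<] c).NeBot := nhdsLT_neBot_of_exists_lt ⟨s, ha.1⟩
        obtain ⟨r, h1, h2⟩ := (hev.and hc.2.2).exists
        rw [← h1, h2]
      rw [this, ncard_empty]
  · have hDe : D = ∅ := by
      refine eq_empty_of_forall_notMem fun c hc => ha ?_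
      obtain rfl := hmem c hc
      exact ⟨hc.1, hc.2.1⟩
    have hxs : x s' = x s := by
      rcases le_or_gt a s with h1 | h1
      · rw [(h s ⟨le_rfl, hs⟩).2 h1, (h s' ⟨hs, le_rfl⟩).2 (h1.trans hs)]
      · have h2 : s' < a := not_le.1 fun h2 => ha ⟨h1, h2⟩
        rw [(h s ⟨le_rfl, hs⟩).1 h1, (h s' ⟨hs, le_rfl⟩).1 h2]
    rw [hDe, ncard_empty, if_neg (by omega)]

/-- For a fine enough partition the discrete count is the number of deaths. -/
theorem eventually_stepDeaths_eq {x : ℝ≥0 → ℕ} (hx : IsCadlagPath x) (t : ℝ≥0) :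
    ∀ᶠ N : ℕ in atTop, stepDeaths x (t / N) N = (deathTimes x t).ncard := by
  choose l hl using hx.exists_piecewise
  choose U hU hUo haU using fun a => eventually_nhds_iff.1 (hl a)
  -- A mesh below the Lebesgue number puts each step inside a neighbourhood containing at most one
  -- jump.
  obtain ⟨δ, hδ, hball⟩ := lebesgue_number_lemma_of_metric (isCompact_Icc (a := 0) (b := t))
    (c := U) hUo (fun a _ => mem_iUnion.2 ⟨a, haU a⟩)
  have hlim : Tendsto (fun N : ℕ => (t : ℝ) / N) atTop (𝓝 0) := tendsto_const_div_atTop_nhds_zero_nat _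
  filter_upwards [hlim.eventually_lt_const hδ, eventually_ge_atTop 1] with N hN hN1
  set h : ℝ≥0 := t / N with hh
  have hhδ : (h : ℝ) < δ := by simpa [hh] using hN
  have hNh : (N : ℝ≥0) * h = t := by
    rw [hh, mul_div_cancel₀]
    exact Nat.cast_ne_zero.2 (by omega)
  have key : ∀ k ≤ N, stepDeaths x h k = (deathTimes x (k * h)).ncard := by
    intro k
    induction k with
    | zero => intro _; simp [stepDeaths, deathTimes_zero]
    | succ k ih =>
      intro hk
      have hle : (k : ℝ≥0) * h ≤ (k + 1 : ℕ) * h := by gcongr; omega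
      have hmem : (k : ℝ≥0) * h ∈ Icc 0 t := by
        refine ⟨zero_le, ?_⟩
        rw [← hNh]
        gcongr
        omega
      obtain ⟨a, ha⟩ := hball _ hmem
      rw [ncard_deathTimes_step hx hle (a := a) (l := l a), ← ih (by omega), stepDeaths,
        Finset.sum_range_succ, stepDeaths]
      intro r hr
      refine hU a r (ha ?_)
      rw [Metric.mem_ball, NNReal.dist_eq, abs_of_nonneg (sub_nonneg.2 (NNReal.coe_le_coe.2 hr.1))]
      have h2 : (r : ℝ) ≤ ((k : ℝ) + 1) * h := by
        have := NNReal.coe_le_coe.2 hr.2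
        push_cast at this
        exact this
      push_cast
      linarith
  rw [key N le_rfl, hNh]

/-! ### The joint generating function of deaths and population -/

/-- The `σ`-algebra is arbitrary and only times up to `k * h` are involved, so that `past X (k * h)`
can be used. -/
theorem measurable_stepDeaths {Ω : Type*} {m : MeasurableSpace Ω} {X : ℝ≥0 → Ω → ℕ} {h : ℝ≥0}
    {k : ℕ} (hX : ∀ r ≤ (k : ℝ≥0) * h, Measurable (X r)) :
    Measurable fun ω => stepDeaths (fun s => X s ω) h k := by
  unfold stepDeaths
  refine Finset.measurable_sum _ fun i hi => ?_
  have hi' : i + 1 ≤ k := Finset.mem_range.1 hi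
  have h1 : ((i + 1 : ℕ) : ℝ≥0) * h ≤ k * h := by gcongr
  have h2 : (i : ℝ≥0) * h ≤ k * h := by gcongr; omega
  exact Measurable.ite (measurableSet_eq_fun ((hX _ h1).add_const 1) (hX _ h2))
    measurable_const measurable_const

theorem measurable_past {Ω : Type*} {X : ℝ≥0 → Ω → ℕ} {s r : ℝ≥0} (hr : r ≤ s) : Measurable[past X s] (X r) :=
  Measurable.mono (comap_measurable (X r))
    (le_iSup (fun r : Iic s => MeasurableSpace.comap (X r) ⊤) ⟨r, hr⟩) le_rfl

section BranchingLaw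

variable {Ω : Type*} [MeasurableSpace Ω] {μ : Measure Ω} {X : ℝ≥0 → Ω → ℕ} {b p q : ℝ}

theorem integrable_of_mem_Icc [IsFiniteMeasure μ] {f : Ω → ℝ} (hf : AEStronglyMeasurable f μ)
    (h : ∀ ω, f ω ∈ Icc (0 : ℝ) 1) : Integrable f μ :=
  Integrable.of_bound hf 1 (Eventually.of_forall fun ω => by
    rw [Real.norm_of_nonneg (h ω).1]; exact (h ω).2)

/-- The Markov property, integrated against a function of the state at time `s + h`. -/
theorem setIntegral_markov [IsFiniteMeasure μ] (hX : ∀ t, Measurable (X t)) {B : Set Ω}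
    {r : ℝ≥0} {f : ℕ → ℝ} {K : ℝ} (hK : HasSum (fun j => f j) K) {c : ℕ → ℝ}
    (hc : ∀ j, c j ∈ Icc (0 : ℝ) 1) {a : ℝ}
    (hB : ∀ j, μ.real (B ∩ {ω | X r ω = j}) * c j = a * f j) :
    ∫ ω in B, c (X r ω) ∂μ = a * K := by
  have hm : Measurable c := measurable_of_countable c
  rw [← integral_map (φ := X r) (f := c) (hX r).aemeasurable hm.aestronglyMeasurable,
    integral_countable (integrable_of_mem_Icc hm.aestronglyMeasurable hc)]
  rw [← (hK.mul_left a).tsum_eq]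
  refine tsum_congr fun j => ?_
  rw [← hB j, smul_eq_mul, map_measureReal_apply (hX r) (measurableSet_singleton j),
    measureReal_restrict_apply ((hX r) (measurableSet_singleton j)), inter_comm]
  rfl

/-- Split according to the count `m` so far, which is an event of the past, and the present state
`i`. On such a cell the Markov property turns the next step into the factor `K`, so the error is at
most `D` times the probability of the cell. -/
theorem abs_integral_step_le [IsProbabilityMeasure μ] (hX : ∀ t, Measurable (X t))
    {P : ℝ → ℕ → ℕ → ℝ}
    (hM : ∀ (s h : ℝ≥0) (i j : ℕ) (A : Set Ω), MeasurableSet[past X s] A →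
      μ.real (A ∩ {ω | X s ω = i} ∩ {ω | X (s + h) ω = j})
        = μ.real (A ∩ {ω | X s ω = i}) * P h i j)
    {v u u' D : ℝ} (hv : v ∈ Icc (0 : ℝ) 1) (hu : u ∈ Icc (0 : ℝ) 1) (hu' : u' ∈ Icc (0 : ℝ) 1)
    {h : ℝ≥0}
    (hK : ∀ i, ∃ K : ℝ, HasSum (fun j => P h i j * ((if j + 1 = i then v else 1) * u ^ j)) K ∧
      |K - u' ^ i| ≤ D) (k : ℕ) :
    |∫ ω, v ^ stepDeaths (fun s => X s ω) h (k + 1) * u ^ X ((k + 1 : ℕ) * h) ω ∂μ -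
      ∫ ω, v ^ stepDeaths (fun s => X s ω) h k * u' ^ X (k * h) ω ∂μ| ≤ D := by
  set S : ℕ → Ω → ℕ := fun k ω => stepDeaths (fun s => X s ω) h k with hS
  have hSm : ∀ k, Measurable (S k) := fun k => measurable_stepDeaths fun r _ => hX r
  have hint : ∀ (k : ℕ) (r : ℝ≥0) (x : ℝ), x ∈ Icc (0 : ℝ) 1 →
      Integrable (fun ω => v ^ S k ω * x ^ X r ω) μ := fun k r x hx => by
    refine integrable_of_mem_Icc ?_ fun ω => ?_
    · exact (((measurable_of_countable fun n : ℕ => v ^ n).comp (hSm k)).mul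
        ((measurable_of_countable fun n : ℕ => x ^ n).comp (hX r))).aestronglyMeasurable
    · exact ⟨mul_nonneg (pow_nonneg hv.1 _) (pow_nonneg hx.1 _),
        mul_le_one₀ (pow_le_one₀ hv.1 hv.2) (pow_nonneg hx.1 _) (pow_le_one₀ hx.1 hx.2)⟩
  set B : ℕ × ℕ → Set Ω := fun c => {ω | S k ω = c.1} ∩ {ω | X (k * h) ω = c.2} with hB
  have hBm : ∀ c, MeasurableSet (B c) := fun c =>
    ((hSm k) (measurableSet_singleton c.1)).inter ((hX _) (measurableSet_singleton c.2))
  have hBd : Pairwise (Function.onFun Disjoint B) := by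
    intro c d hcd
    refine Set.disjoint_left.2 fun ω h1 h2 => hcd ?_
    exact Prod.ext (h1.1.symm.trans h2.1) (h1.2.symm.trans h2.2)
  have hBU : ⋃ c, B c = univ := by
    refine eq_univ_of_forall fun ω => mem_iUnion.2 ⟨(S k ω, X (k * h) ω), rfl, rfl⟩
  have hsum : ∀ {f : Ω → ℝ}, Integrable f μ → HasSum (fun c => ∫ ω in B c, f ω ∂μ) (∫ ω, f ω ∂μ) := by
    intro f hf
    have := hasSum_integral_iUnion hBm hBd hf.integrableOn
    rwa [hBU, setIntegral_univ] at this
  have h1 := (hsum (hint (k + 1) ((k + 1 : ℕ) * h) u hu)).sub (hsum (hint k (k * h) u' hu'))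
  have h2 := (hsum (integrable_const (μ := μ) (1 : ℝ))).mul_right D
  simp only [integral_const, smul_eq_mul, mul_one, probReal_univ, one_mul] at h2
  rw [← Real.norm_eq_abs]
  refine h1.norm_le_of_bounded h2 fun c => ?_
  obtain ⟨m, i⟩ := c
  obtain ⟨K, hKs, hKle⟩ := hK i
  have hA : MeasurableSet[past X (k * h)] {ω | S k ω = m} := by
    have : Measurable[past X (k * h)] (S k) :=
      measurable_stepDeaths fun r hr => measurable_past hr
    exact this (measurableSet_singleton m)
  have hBeq : ∀ ω ∈ B (m, i), S k ω = m ∧ X (k * h) ω = i := fun ω hω => hω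
  have e1 : ∫ ω in B (m, i), v ^ S (k + 1) ω * u ^ X ((k + 1 : ℕ) * h) ω ∂μ =
      v ^ m * (μ.real (B (m, i)) * K) := by
    rw [← setIntegral_markov (μ := μ) (B := B (m, i)) hX (r := (k + 1 : ℕ) * h)
      (c := fun j => (if j + 1 = i then v else 1) * u ^ j) (a := μ.real (B (m, i))) hKs
      (fun j => ?_) (fun j => ?_), ← integral_const_mul]
    · refine setIntegral_congr_fun (hBm _) fun ω hω => ?_
      obtain ⟨a1, a2⟩ := hBeq ω hω
      have : S (k + 1) ω = m + if X ((k + 1 : ℕ) * h) ω + 1 = i then 1 else 0 := by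
        rw [← a1, ← a2]
        simp only [hS, stepDeaths, Finset.sum_range_succ]
      simp only [this]
      split_ifs
      · rw [pow_succ]; ring
      · simp
    · refine ⟨mul_nonneg (by split_ifs <;> simp [hv.1]) (pow_nonneg hu.1 _), mul_le_one₀
        (by split_ifs <;> simp [hv.2]) (pow_nonneg hu.1 _) (pow_le_one₀ hu.1 hu.2)⟩
    · have := hM (k * h) h i j _ hA
      have e : (k : ℝ≥0) * h + h = (k + 1 : ℕ) * h := by push_cast; ring
      rw [e] at this
      rw [hB]
      simp only
      rw [this]
      ring
  have e2 : ∫ ω in B (m, i), v ^ S k ω * u' ^ X (k * h) ω ∂μ = v ^ m * (μ.real (B (m, i)) * u' ^ i) := by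
    have : ∫ ω in B (m, i), v ^ S k ω * u' ^ X (k * h) ω ∂μ =
        ∫ ω in B (m, i), v ^ m * u' ^ i ∂μ := by
      refine setIntegral_congr_fun (hBm _) fun ω hω => ?_
      obtain ⟨a1, a2⟩ := hBeq ω hω
      simp only [a1, a2]
    rw [this, setIntegral_const, smul_eq_mul]
    ring
  have e3 : v ^ m * (μ.real (B (m, i)) * K) - v ^ m * (μ.real (B (m, i)) * u' ^ i) =
      v ^ m * (μ.real (B (m, i)) * (K - u' ^ i)) := by ring
  rw [e1, e2, e3, Real.norm_eq_abs, abs_mul, abs_mul, abs_of_nonneg (pow_nonneg hv.1 m),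
    abs_of_nonneg measureReal_nonneg]
  simp only [measureReal_restrict_apply_univ]
  calc v ^ m * (μ.real (B (m, i)) * |K - u' ^ i|) ≤ 1 * (μ.real (B (m, i)) * D) := by
        gcongr
        exact pow_le_one₀ hv.1 hv.2
    _ = μ.real (B (m, i)) * D := one_mul _

theorem IsMarkovBranchingProcess.ae_tendsto_stepDeaths
    (hX : IsMarkovBranchingProcess (rates03 b p q) μ X) (t : ℝ≥0) :
    ∀ᵐ ω ∂μ, ∀ᶠ N : ℕ in atTop, stepDeaths (fun s => X s ω) (t / N) N = deathNumber X t ω := by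
  filter_upwards [hX.cadlag] with ω hω using eventually_stepDeaths_eq hω t

theorem IsMarkovBranchingProcess.aemeasurable_deathNumber
    (hX : IsMarkovBranchingProcess (rates03 b p q) μ X) (t : ℝ≥0) :
    AEMeasurable (deathNumber X t) μ := by
  refine aemeasurable_of_tendsto_metrizable_ae (u := atTop)
    (f := fun (N : ℕ) ω => stepDeaths (fun s => X s ω) (t / N) N)
    (fun N => (measurable_stepDeaths fun r _ => hX.measurable r).aemeasurable) ?_
  filter_upwards [hX.ae_tendsto_stepDeaths t] with ω hω
  exact tendsto_const_nhds.congr' (hω.mono fun N hN => hN.symm)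

variable [IsProbabilityMeasure μ]

theorem integrable_pow_mul_pow {Y Z : Ω → ℕ} (hY : AEMeasurable Y μ) (hZ : AEMeasurable Z μ)
    {v w : ℝ} (hv : v ∈ Icc (0 : ℝ) 1) (hw : w ∈ Icc (0 : ℝ) 1) :
    Integrable (fun ω => v ^ Y ω * w ^ Z ω) μ := by
  refine integrable_of_mem_Icc ?_ fun ω => ?_
  · exact (((measurable_of_countable fun n : ℕ => v ^ n).comp_aemeasurable hY).mul
      ((measurable_of_countable fun n : ℕ => w ^ n).comp_aemeasurable hZ)).aestronglyMeasurable
  · exact ⟨mul_nonneg (pow_nonneg hv.1 _) (pow_nonneg hw.1 _),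
      mul_le_one₀ (pow_le_one₀ hv.1 hv.2) (pow_nonneg hw.1 _) (pow_le_one₀ hw.1 hw.2)⟩

/-- The joint generating function of the death number and the population size, at `w < 1`. -/
theorem IsMarkovBranchingProcess.integral_pow_mul_pow (h : Admissible b p q)
    (hX : IsMarkovBranchingProcess (rates03 b p q) μ X) (hX0 : ∀ᵐ ω ∂μ, X 0 ω = 1)
    {v w : ℝ} (hv : v ∈ Icc (0 : ℝ) 1) (hw : w < 1) {y : ℝ → ℝ} (hy : IsFlow b p q v w y)
    (t : ℝ≥0) : ∫ ω, v ^ deathNumber X t ω * w ^ X t ω ∂μ = y t := by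
  obtain ⟨P, hP, hF, hM⟩ := hX.markov
  obtain ⟨C, hC0, hC⟩ := exists_abs_weighted_sub_le h hP hF hv hw hy t
  have hw0 : w ∈ Icc (0 : ℝ) 1 := by
    have := hy.mem 0 le_rfl
    rwa [hy.init] at this
  have main : ∀ N : ℕ, 1 ≤ N →
      |∫ ω, v ^ stepDeaths (fun s => X s ω) (t / N) N * w ^ X t ω ∂μ - y t| ≤ C * t ^ 2 / N := by
    intro N hN
    have hN0 : (N : ℝ) ≠ 0 := Nat.cast_ne_zero.2 (by omega)
    set d : ℝ≥0 := t / N with hd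
    have hNd : (N : ℝ≥0) * d = t := by
      rw [hd, mul_div_cancel₀]
      exact Nat.cast_ne_zero.2 (by omega)
    have hNd' : (N : ℝ) * d = t := by rw [← hNd]; push_cast; rfl
    -- After `k` steps the state is weighted by the flow run for the remaining time. For `k = 0` the
    -- integral is `y t`, as `X 0 = 1`; for `k = N` the base is `w`; each step costs `C d²`.
    have key : ∀ k ≤ N, |∫ ω, v ^ stepDeaths (fun s => X s ω) d k *
        y ((N - k : ℝ) * d) ^ X (k * d) ω ∂μ - y t| ≤ k * (C * d ^ 2) := by
      intro k
      induction k with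
      | zero =>
        intro _
        have : ∫ ω, v ^ stepDeaths (fun s => X s ω) d 0 *
            y ((N - (0 : ℕ) : ℝ) * d) ^ X ((0 : ℕ) * d) ω ∂μ = ∫ ω, y t ∂μ := by
          refine integral_congr_ae ?_
          filter_upwards [hX0] with ω hω
          simp [stepDeaths, hω, hNd']
        rw [this]
        simp
      | succ k ih =>
        intro hk
        have hk' : (k : ℝ) + 1 ≤ N := by exact_mod_cast hk
        have hs : (0 : ℝ) ≤ (N - (k + 1 : ℕ) : ℝ) * d := by
          push_cast
          exact mul_nonneg (by linarith) d.2
        have hadd : (N - (k + 1 : ℕ) : ℝ) * d + d = (N - k) * d := by push_cast; ring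
        have hs' : (0 : ℝ) ≤ (N - k) * d := by rw [← hadd]; exact add_nonneg hs d.2
        have hle : (N - (k + 1 : ℕ) : ℝ) * d + d ≤ t := by
          rw [hadd, ← hNd']
          have := mul_nonneg k.cast_nonneg (α := ℝ) d.2
          simp only [NNReal.val_eq_coe] at this
          linarith
        have h1 := abs_integral_step_le hX.measurable hM hv (hy.mem _ hs) (hy.mem _ hs')
          (h := d) (D := C * d ^ 2) (fun i => by
            have := hC _ d hs d.2 hle i
            rwa [hadd] at this) k
        have h2 := ih (by omega)
        have := abs_sub_le (∫ ω, v ^ stepDeaths (fun s => X s ω) d (k + 1) *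
            y ((N - (k + 1 : ℕ) : ℝ) * d) ^ X ((k + 1 : ℕ) * d) ω ∂μ)
          (∫ ω, v ^ stepDeaths (fun s => X s ω) d k * y ((N - k : ℝ) * d) ^ X (k * d) ω ∂μ) (y t)
        push_cast at *
        linarith
    have := key N le_rfl
    rw [hNd, sub_self, zero_mul, hy.init] at this
    refine this.trans_eq ?_
    rw [← hNd']
    field_simp
  have l₁ : Tendsto (fun N : ℕ => ∫ ω, v ^ stepDeaths (fun s => X s ω) (t / N) N * w ^ X t ω ∂μ)
      atTop (𝓝 (y t)) := by
    rw [tendsto_iff_norm_sub_tendsto_zero]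
    refine squeeze_zero' (Eventually.of_forall fun _ => norm_nonneg _)
      ((eventually_ge_atTop 1).mono main) (tendsto_const_div_atTop_nhds_zero_nat _)
  have l₂ : Tendsto (fun N : ℕ => ∫ ω, v ^ stepDeaths (fun s => X s ω) (t / N) N * w ^ X t ω ∂μ)
      atTop (𝓝 (∫ ω, v ^ deathNumber X t ω * w ^ X t ω ∂μ)) := by
    refine tendsto_integral_of_dominated_convergence (fun _ => 1) (fun N => ?_)
      (integrable_const _) (fun N => Eventually.of_forall fun ω => ?_) ?_
    · exact (integrable_pow_mul_pow (measurable_stepDeaths fun r _ => hX.measurable r).aemeasurable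
        (hX.measurable t).aemeasurable hv hw0).aestronglyMeasurable
    · rw [Real.norm_of_nonneg (mul_nonneg (pow_nonneg hv.1 _) (pow_nonneg hw0.1 _))]
      exact mul_le_one₀ (pow_le_one₀ hv.1 hv.2) (pow_nonneg hw0.1 _) (pow_le_one₀ hw0.1 hw0.2)
    · filter_upwards [hX.ae_tendsto_stepDeaths t] with ω hω
      exact tendsto_const_nhds.congr' (hω.mono fun N hN => by simp only [hN])
  exact tendsto_nhds_unique l₂ l₁

/-- The generating function of the death number. -/
theorem IsMarkovBranchingProcess.integral_pow_deathNumber (h : Admissible b p q)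
    (hX : IsMarkovBranchingProcess (rates03 b p q) μ X) (hX0 : ∀ᵐ ω ∂μ, X 0 ω = 1)
    {v : ℝ} (hv : v ∈ Icc (0 : ℝ) 1) {y : ℝ → ℝ} (hy : IsFlow b p q v 1 y)
    (t : ℝ≥0) : ∫ ω, v ^ deathNumber X t ω ∂μ = y t := by
  -- The uniform step estimate fails to cover `w = 1`, which is reached as a limit from below.
  obtain ⟨w, -, hw, hw1⟩ := exists_seq_strictMono_tendsto' (zero_lt_one' ℝ)
  have hw0 : ∀ n, w n ∈ Icc (0 : ℝ) 1 := fun n => Ioo_subset_Icc_self (hw n)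
  choose z hz using fun n => exists_isFlow h hv (hw0 n)
  have e := fun n => hX.integral_pow_mul_pow h hX0 hv (hw n).2 (hz n) t
  have l₁ : Tendsto (fun n => z n t) atTop (𝓝 (y t)) := by
    rw [tendsto_iff_norm_sub_tendsto_zero]
    refine squeeze_zero (fun _ => norm_nonneg _) (fun n => (hz n).dist_le h hy t.2) ?_
    simpa using ((hw1.sub_const 1).abs).mul_const (Real.exp (b * 4 * t))
  have l₂ : Tendsto (fun n => ∫ ω, v ^ deathNumber X t ω * w n ^ X t ω ∂μ)
      atTop (𝓝 (∫ ω, v ^ deathNumber X t ω ∂μ)) := by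
    refine tendsto_integral_of_dominated_convergence (fun _ => 1) (fun n => ?_)
      (integrable_const _) (fun n => Eventually.of_forall fun ω => ?_)
      (Eventually.of_forall fun ω => ?_)
    · exact (integrable_pow_mul_pow (hX.aemeasurable_deathNumber t)
        (hX.measurable t).aemeasurable hv (hw0 n)).aestronglyMeasurable
    · rw [Real.norm_of_nonneg (mul_nonneg (pow_nonneg hv.1 _) (pow_nonneg (hw0 n).1 _))]
      exact mul_le_one₀ (pow_le_one₀ hv.1 hv.2) (pow_nonneg (hw0 n).1 _)
        (pow_le_one₀ (hw0 n).1 (hw0 n).2)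
    · simpa using (hw1.pow (X t ω)).const_mul (v ^ deathNumber X t ω)
  simp only [e] at l₂
  exact tendsto_nhds_unique l₂ l₁

end BranchingLaw

/-! ### Power series and triple convolutions -/

/-- The coefficients of the cube of a power series. -/
def cubeCoeff (a : ℕ → ℝ) (n : ℕ) : ℝ :=
  ∑ x ∈ Finset.HasAntidiagonal.antidiagonal n, a x.1 * ∑ y ∈ Finset.HasAntidiagonal.antidiagonal x.2, a y.1 * a y.2

theorem cubeCoeff_nonneg {a : ℕ → ℝ} (ha : ∀ n, 0 ≤ a n) (n : ℕ) : 0 ≤ cubeCoeff a n :=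
  Finset.sum_nonneg fun _ _ => mul_nonneg (ha _) (Finset.sum_nonneg fun _ _ => mul_nonneg (ha _) (ha _))

theorem hasSum_cubeCoeff {a : ℕ → ℝ} {v A : ℝ} (hA : HasSum (fun n => a n * v ^ n) A) :
    HasSum (fun n => cubeCoeff a n * v ^ n) (A ^ 3) := by
  set f : ℕ → ℝ := fun n => a n * v ^ n with hf
  have hf' : Summable fun n => ‖f n‖ := hA.summable.norm
  have h2 := tsum_mul_tsum_eq_tsum_sum_antidiagonal_of_summable_norm hf' hf'
  have h2s := summable_norm_sum_mul_antidiagonal_of_summable_norm hf' hf'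
  have h3 := tsum_mul_tsum_eq_tsum_sum_antidiagonal_of_summable_norm hf' h2s
  have h3s := (summable_norm_sum_mul_antidiagonal_of_summable_norm hf' h2s).of_norm
  have h := h3s.hasSum
  rw [← h3, ← h2, hA.tsum_eq, show A * (A * A) = A ^ 3 by ring] at h
  refine h.congr_fun fun n => ?_
  rw [cubeCoeff, Finset.sum_mul]
  refine Finset.sum_congr rfl fun x hx => ?_
  rw [mul_assoc, Finset.sum_mul, Finset.mul_sum, Finset.mul_sum]
  refine Finset.sum_congr rfl fun y hy => ?_
  rw [← Finset.HasAntidiagonal.mem_antidiagonal.1 hx, ← Finset.HasAntidiagonal.mem_antidiagonal.1 hy, hf]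
  ring

theorem cubeCoeff_eq_sum_triples (a : ℕ → ℝ) (n : ℕ) :
    cubeCoeff a n = ∑ x ∈ Finset.range (n + 1) ×ˢ Finset.range (n + 1) ×ˢ Finset.range (n + 1) with
      x.1 + x.2.1 + x.2.2 = n, a x.1 * a x.2.1 * a x.2.2 := by
  simp only [cubeCoeff, Finset.mul_sum]
  rw [Finset.sum_sigma']
  refine Finset.sum_bij' (fun x _ => (x.1.1, x.2.1, x.2.2)) (fun x _ => ⟨(x.1, x.2.1 + x.2.2), x.2⟩)
    ?_ ?_ ?_ ?_ ?_
  · rintro ⟨⟨i, m⟩, j, k⟩ h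
    simp at h ⊢
    omega
  · rintro ⟨i, j, k⟩ h
    simp at h ⊢
    omega
  · rintro ⟨⟨i, m⟩, j, k⟩ h
    simp at h ⊢
    omega
  · rintro ⟨i, j, k⟩ h
    simp
  · rintro ⟨⟨i, m⟩, j, k⟩ h
    simp [mul_assoc]

/-- If one index equals `n`, the other two are `0`; for `n ≥ 1` there are three such triples. This
isolates the part linear in `a n`. -/
theorem cubeCoeff_eq_cubicConv_add (a : ℕ → ℝ) {n : ℕ} (hn : 1 ≤ n) :
    cubeCoeff a n = cubicConv a n + 3 * a 0 ^ 2 * a n := by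
  rw [cubeCoeff_eq_sum_triples, ← Finset.sum_filter_add_sum_filter_not _
    (fun x : ℕ × ℕ × ℕ => x.1 < n ∧ x.2.1 < n ∧ x.2.2 < n), cubicConv]
  congr 1
  · refine Finset.sum_congr ?_ fun _ _ => rfl
    ext ⟨i, j, k⟩
    simp
    omega
  · have : (({x ∈ Finset.range (n + 1) ×ˢ Finset.range (n + 1) ×ˢ Finset.range (n + 1) |
        x.1 + x.2.1 + x.2.2 = n} : Finset (ℕ × ℕ × ℕ)).filter
          fun x => ¬(x.1 < n ∧ x.2.1 < n ∧ x.2.2 < n)) = {(n, 0, 0), (0, n, 0), (0, 0, n)} := by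
      ext ⟨i, j, k⟩
      simp
      omega
    rw [this, Finset.sum_insert (by simp; omega), Finset.sum_insert (by simp; omega),
      Finset.sum_singleton]
    ring

/-- A power series that vanishes on `(0, 1)` has zero coefficients. -/
theorem eq_zero_of_hasSum_pow {R : ℕ → ℝ}
    (h : ∀ v ∈ Ioo (0 : ℝ) 1, HasSum (fun n => R n * v ^ n) 0) (n : ℕ) : R n = 0 := by
  induction n using Nat.strong_induction_on with
  | _ n ih =>
  have tail : ∀ v ∈ Ioo (0 : ℝ) 1, HasSum (fun m => R (m + (n + 1)) * v ^ (m + 1)) (-R n) := by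
    intro v hv
    have h1 := (hasSum_nat_add_iff' (n + 1)).2 (h v hv)
    have h2 : ∑ i ∈ Finset.range (n + 1), R i * v ^ i = R n * v ^ n := by
      rw [Finset.sum_range_succ, Finset.sum_eq_zero, zero_add]
      intro i hi
      rw [ih i (Finset.mem_range.1 hi), zero_mul]
    rw [h2, zero_sub] at h1
    have h3 := h1.mul_right (v ^ n)⁻¹
    have hvn : v ^ n ≠ 0 := pow_ne_zero _ hv.1.ne'
    rw [neg_mul, mul_assoc, mul_inv_cancel₀ hvn, mul_one] at h3
    refine h3.congr_fun fun m => ?_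
    rw [show m + (n + 1) = (m + 1) + n by ring, pow_add v (m + 1) n]
    field_simp
  -- For `v < 1 / 2` the tail is compared termwise with that at `1 / 2`, which gains a factor `2 v`;
  -- then `v → 0`.
  have hs := (tail (1 / 2) ⟨by norm_num, by norm_num⟩).summable.norm
  set M := ∑' m, ‖R (m + (n + 1)) * (1 / 2 : ℝ) ^ (m + 1)‖ with hM
  have hle : ∀ v ∈ Ioo (0 : ℝ) (1 / 2), |R n| ≤ 2 * v * M := by
    intro v hv
    have h1 := tail v ⟨hv.1, hv.2.trans (by norm_num)⟩
    rw [← Real.norm_eq_abs, ← norm_neg]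
    refine h1.norm_le_of_bounded (hs.hasSum.mul_left (2 * v)) fun m => ?_
    · rw [norm_mul, norm_mul, norm_pow, norm_pow, Real.norm_of_nonneg hv.1.le,
        Real.norm_of_nonneg (show (0 : ℝ) ≤ 1 / 2 by norm_num)]
      have hvm : v ^ (m + 1) ≤ 2 * v * (1 / 2) ^ (m + 1) := by
        have := hv.1
        have := hv.2.le
        calc v ^ (m + 1) = v ^ m * v := pow_succ _ _
          _ ≤ (1 / 2) ^ m * v := by gcongr
          _ = 2 * v * (1 / 2) ^ (m + 1) := by rw [pow_succ]; ring
      calc ‖R (m + (n + 1))‖ * v ^ (m + 1)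
          ≤ ‖R (m + (n + 1))‖ * (2 * v * (1 / 2) ^ (m + 1)) := by gcongr
        _ = _ := by ring
  have hlim : Tendsto (fun v : ℝ => 2 * v * M) (𝓝[>] 0) (𝓝 0) := by
    have : Tendsto (fun v : ℝ => 2 * v * M) (𝓝 0) (𝓝 (2 * 0 * M)) := by
      apply Continuous.tendsto; fun_prop
    simp only [mul_zero, zero_mul] at this
    exact this.mono_left nhdsWithin_le_nhds
  have := ge_of_tendsto hlim (by
    filter_upwards [Ioo_mem_nhdsGT (show (0 : ℝ) < 1 / 2 by norm_num)] with v hv using hle v hv)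
  exact abs_nonpos_iff.1 this

/-! ### The law of the death number at a fixed time -/

section BranchingLaw

variable {Ω : Type*} [MeasurableSpace Ω] {μ : Measure Ω} {X : ℝ≥0 → Ω → ℕ} {b p q : ℝ}

theorem hasSum_measureReal_fiber [IsFiniteMeasure μ] {Y : Ω → ℕ} (hY : AEMeasurable Y μ)
    {c : ℕ → ℝ} (hc : ∀ n, c n ∈ Icc (0 : ℝ) 1) :
    HasSum (fun n => μ.real {ω | Y ω = n} * c n) (∫ ω, c (Y ω) ∂μ) := by
  have hm : Measurable c := measurable_of_countable c
  have h := hasSum_integral_iUnion (μ := μ.map Y) (s := fun n : ℕ => {n}) (f := c)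
    (fun n => measurableSet_singleton n)
    (fun m n hmn => Set.disjoint_singleton.2 hmn)
    (integrable_of_mem_Icc hm.aestronglyMeasurable hc).integrableOn
  rw [iUnion_of_singleton, setIntegral_univ, integral_map hY hm.aestronglyMeasurable] at h
  refine h.congr_fun fun n => ?_
  rw [integral_singleton, smul_eq_mul, map_measureReal_apply_of_aemeasurable hY
    (measurableSet_singleton n)]
  rfl

theorem pow_mem_Icc {v : ℝ} (hv : v ∈ Icc (0 : ℝ) 1) (n : ℕ) : v ^ n ∈ Icc (0 : ℝ) 1 :=
  ⟨pow_nonneg hv.1 n, pow_le_one₀ hv.1 hv.2⟩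

theorem deathProb_nonneg (n : ℕ) (t : ℝ) : 0 ≤ deathProb μ X n t := measureReal_nonneg

variable [IsProbabilityMeasure μ]

theorem IsMarkovBranchingProcess.hasSum_deathProb (h : Admissible b p q)
    (hX : IsMarkovBranchingProcess (rates03 b p q) μ X) (hX0 : ∀ᵐ ω ∂μ, X 0 ω = 1)
    {v : ℝ} (hv : v ∈ Icc (0 : ℝ) 1) {y : ℝ → ℝ} (hy : IsFlow b p q v 1 y)
    {t : ℝ} (ht : 0 ≤ t) : HasSum (fun n => deathProb μ X n t * v ^ n) (y t) := by
  have := hasSum_measureReal_fiber (hX.aemeasurable_deathNumber t.toNNReal) (pow_mem_Icc hv)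
  rwa [hX.integral_pow_deathNumber h hX0 hv hy, Real.coe_toNNReal t ht] at this

theorem IsCadlagPath.ncard_deathTimes_mono {x : ℝ≥0 → ℕ} (hx : IsCadlagPath x) {s t : ℝ≥0}
    (hst : s ≤ t) : (deathTimes x s).ncard ≤ (deathTimes x t).ncard :=
  ncard_le_ncard (deathTimes_mono x hst) (deathTimes_finite hx t)

/-- If `k > n` both indicators vanish; if `k ≤ n` and `k < m`, the right bracket is at least `(1 /
2) ^ (n + 1)`. As `Y` is nondecreasing, continuity of the generating function at `v = 1 / 2` passes
to each `g_n`. -/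
theorem abs_indicator_sub_le {k m n : ℕ} (hkm : k ≤ m) :
    |(if k = n then (1 : ℝ) else 0) - (if m = n then 1 else 0)| ≤
      2 ^ (n + 1) * ((1 / 2) ^ k - (1 / 2) ^ m) := by
  have hanti : ∀ {i j : ℕ}, i ≤ j → (1 / 2 : ℝ) ^ j ≤ (1 / 2) ^ i := fun hij =>
    pow_le_pow_of_le_one (by norm_num) (by norm_num) hij
  rcases hkm.eq_or_lt with rfl | hlt
  · simp
  rcases lt_or_ge n k with hn | hn
  · rw [if_neg (by omega), if_neg (by omega), sub_self, abs_zero]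
    exact mul_nonneg (by positivity) (sub_nonneg.2 (hanti hkm))
  · have h1 : |(if k = n then (1 : ℝ) else 0) - (if m = n then 1 else 0)| ≤ 1 := by
      split_ifs <;> simp
    refine h1.trans ?_
    have h2 : (1 / 2 : ℝ) ^ m ≤ (1 / 2) ^ (k + 1) := hanti hlt
    have h3 : (1 / 2 : ℝ) ^ (n + 1) ≤ (1 / 2) ^ (k + 1) := hanti (by omega)
    have h4 : (1 / 2 : ℝ) ^ k = 2 * (1 / 2) ^ (k + 1) := by rw [pow_succ]; ring
    have h5 : (2 : ℝ) ^ (n + 1) * (1 / 2) ^ (n + 1) = 1 := by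
      rw [← mul_pow]; norm_num
    calc (1 : ℝ) = 2 ^ (n + 1) * (1 / 2) ^ (n + 1) := h5.symm
      _ ≤ 2 ^ (n + 1) * ((1 / 2) ^ k - (1 / 2) ^ m) := by gcongr; linarith

theorem IsMarkovBranchingProcess.abs_deathProb_sub_le (h : Admissible b p q)
    (hX : IsMarkovBranchingProcess (rates03 b p q) μ X) (hX0 : ∀ᵐ ω ∂μ, X 0 ω = 1)
    {y : ℝ → ℝ} (hy : IsFlow b p q (1 / 2) 1 y) (n : ℕ) {s t : ℝ} (hs : 0 ≤ s) (hst : s ≤ t) :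
    |deathProb μ X n s - deathProb μ X n t| ≤ 2 ^ (n + 1) * (y s - y t) := by
  have hhalf : (1 / 2 : ℝ) ∈ Icc (0 : ℝ) 1 := ⟨by norm_num, by norm_num⟩
  have key : ∀ r : ℝ≥0, deathProb μ X n r = ∫ ω, (if deathNumber X r ω = n then (1 : ℝ) else 0) ∂μ ∧
      Integrable (fun ω => if deathNumber X r ω = n then (1 : ℝ) else 0) μ ∧
      Integrable (fun ω => (1 / 2 : ℝ) ^ deathNumber X r ω) μ := by
    intro r
    have hm := hX.aemeasurable_deathNumber r
    have hc : ∀ k : ℕ, (if k = n then (1 : ℝ) else 0) ∈ Icc (0 : ℝ) 1 := fun k => by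
      split_ifs <;> simp
    refine ⟨?_, integrable_of_mem_Icc ((measurable_of_countable
      fun k : ℕ => if k = n then (1 : ℝ) else 0).comp_aemeasurable hm).aestronglyMeasurable
      fun ω => hc _, integrable_of_mem_Icc ((measurable_of_countable
      fun k : ℕ => (1 / 2 : ℝ) ^ k).comp_aemeasurable hm).aestronglyMeasurable
      fun ω => pow_mem_Icc hhalf _⟩
    rw [← (hasSum_measureReal_fiber hm hc).tsum_eq, tsum_eq_single n (fun k hk => by simp [hk])]
    simp [deathProb]
  have ht := hs.trans hst
  lift s to ℝ≥0 using hs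
  lift t to ℝ≥0 using ht
  obtain ⟨es, is, js⟩ := key s
  obtain ⟨et, it, jt⟩ := key t
  rw [es, et, ← hX.integral_pow_deathNumber h hX0 hhalf hy, ← hX.integral_pow_deathNumber h hX0
    hhalf hy, ← integral_sub is it, ← integral_sub js jt, ← integral_const_mul]
  refine (abs_integral_le_integral_abs).trans (integral_mono_ae (is.sub it).abs
    ((js.sub jt).const_mul _) ?_)
  filter_upwards [hX.cadlag] with ω hω
  exact abs_indicator_sub_le (hω.ncard_deathTimes_mono (NNReal.coe_le_coe.1 hst))

theorem IsMarkovBranchingProcess.continuousOn_deathProb (h : Admissible b p q)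
    (hX : IsMarkovBranchingProcess (rates03 b p q) μ X) (hX0 : ∀ᵐ ω ∂μ, X 0 ω = 1) (n : ℕ) :
    ContinuousOn (deathProb μ X n) (Ici 0) := by
  obtain ⟨y, hy⟩ := exists_isFlow (v := 1 / 2) (w := 1) h ⟨by norm_num, by norm_num⟩ (by simp)
  have hle : ∀ s ∈ Ici (0 : ℝ), ∀ t ∈ Ici (0 : ℝ),
      |deathProb μ X n s - deathProb μ X n t| ≤ 2 ^ (n + 1) * |y s - y t| := by
    intro s hs t ht
    rcases le_total s t with hst | hst
    · exact (hX.abs_deathProb_sub_le h hX0 hy n hs hst).trans (by gcongr; exact le_abs_self _)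
    · rw [abs_sub_comm, abs_sub_comm (y s)]
      exact (hX.abs_deathProb_sub_le h hX0 hy n ht hst).trans (by gcongr; exact le_abs_self _)
  intro t ht
  rw [ContinuousWithinAt, tendsto_iff_norm_sub_tendsto_zero]
  have h2 : Tendsto (fun s => (2 : ℝ) ^ (n + 1) * |y s - y t|) (𝓝[Ici 0] t) (𝓝 0) := by
    have := ((hy.continuousOn t ht).sub_const (y t)).abs.const_mul ((2 : ℝ) ^ (n + 1))
    simpa using this
  refine squeeze_zero' (Eventually.of_forall fun _ => norm_nonneg _) ?_ h2
  filter_upwards [self_mem_nhdsWithin] with s hs using hle s hs t ht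

/-- The integral form of the equation for the coefficients of the generating function. -/
theorem IsMarkovBranchingProcess.deathProb_eq_integral (h : Admissible b p q)
    (hX : IsMarkovBranchingProcess (rates03 b p q) μ X) (hX0 : ∀ᵐ ω ∂μ, X 0 ω = 1) (n : ℕ)
    {t : ℝ} (ht : 0 ≤ t) :
    deathProb μ X n t = (if n = 0 then 1 else 0) + ∫ s in (0 : ℝ)..t,
      b * (p * (if n = 1 then 1 else 0) - deathProb μ X n s +
        q * cubeCoeff (fun k => deathProb μ X k s) n) := by
  set g : ℕ → ℝ → ℝ := deathProb μ X with hg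
  set k : ℕ → ℝ → ℝ := fun n s => b * (p * (if n = 1 then 1 else 0) - g n s +
        q * cubeCoeff (fun k => g k s) n) with hk
  have hb := h.b_pos
  have hgc : ∀ n, ContinuousOn (g n) (Ici 0) := hX.continuousOn_deathProb h hX0
  have hg0 : ∀ n s, 0 ≤ g n s := fun n s => deathProb_nonneg n s
  -- At `v = 1` the flow is constant, so the masses and the coefficients of their cube both sum to
  -- `1`; this bounds `k n` uniformly.
  have hg1 : ∀ s, 0 ≤ s → HasSum (fun n => g n s * 1 ^ n) 1 := fun s hs =>
    hX.hasSum_deathProb h hX0 (right_mem_Icc.2 zero_le_one) (isFlow_one h) hs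
  have hgle : ∀ n s, 0 ≤ s → g n s ≤ 1 := fun n s hs => by
    simpa using le_hasSum (hg1 s hs) n fun m _ => by simpa using hg0 m s
  have hcle : ∀ n s, 0 ≤ s → cubeCoeff (fun k => g k s) n ≤ 1 := fun n s hs => by
    simpa using le_hasSum (hasSum_cubeCoeff (hg1 s hs)) n fun m _ => by
      simpa using cubeCoeff_nonneg (fun k => hg0 k s) m
  have hc0 : ∀ n s, 0 ≤ cubeCoeff (fun k => g k s) n := fun n s =>
    cubeCoeff_nonneg (fun k => hg0 k s) n
  have hkc : ∀ n, ContinuousOn (k n) (Ici 0) := by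
    intro n
    simp only [hk, cubeCoeff]
    fun_prop
  have hkb : ∀ n s, 0 ≤ s → |k n s| ≤ b * 2 := by
    intro n s hs
    rw [hk, abs_mul, abs_of_pos hb]
    gcongr
    have h1 : p * (if n = 1 then (1 : ℝ) else 0) ≤ p := by
      split_ifs <;> simp [h.p_pos.le]
    have h1' : 0 ≤ p * (if n = 1 then (1 : ℝ) else 0) := by
      split_ifs <;> simp [h.p_pos.le]
    have h2 := mul_nonneg h.q_pos.le (hc0 n s)
    have h3 : q * cubeCoeff (fun k => g k s) n ≤ q :=
      mul_le_of_le_one_right h.q_pos.le (hcle n s hs)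
    rw [abs_le]
    constructor <;> linarith [hg0 n s, hgle n s hs, h.add_eq_one]
  have hz : ∀ v ∈ Ioo (0 : ℝ) 1,
      HasSum (fun n => (g n t - (if n = 0 then 1 else 0) - ∫ s in (0 : ℝ)..t, k n s) * v ^ n) 0 := by
    intro v hv
    have hv' := Ioo_subset_Icc_self hv
    obtain ⟨y, hy⟩ := exists_isFlow (w := 1) h hv' (by simp)
    have s1 := hX.hasSum_deathProb h hX0 hv' hy ht
    have s2 : HasSum (fun n : ℕ => (if n = 0 then (1 : ℝ) else 0) * v ^ n) 1 := by
      simpa using hasSum_single (f := fun n : ℕ => (if n = 0 then (1 : ℝ) else 0) * v ^ n) 0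
        (fun n hn => by simp [hn])
    have hds : ∀ s, 0 ≤ s → HasSum (fun n => k n s * v ^ n) (drift b p q v (y s)) := by
      intro s hs
      have a1 := hX.hasSum_deathProb h hX0 hv' hy hs
      have a2 := hasSum_cubeCoeff a1
      have a3 : HasSum (fun n : ℕ => (if n = 1 then (1 : ℝ) else 0) * v ^ n) v := by
        simpa using hasSum_single (f := fun n : ℕ => (if n = 1 then (1 : ℝ) else 0) * v ^ n) 1
          (fun n hn => by simp [hn])
      refine ((((a3.mul_left p).sub a1).add (a2.mul_left q)).mul_left b).congr_fun fun n => ?_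
      simp only [hk]
      ring
    have hint : ∫ s in (0 : ℝ)..t, drift b p q v (y s) = y t - 1 := by
      rw [← hy.init]
      refine intervalIntegral.integral_eq_sub_of_hasDerivAt_of_le ht
        (hy.continuousOn.mono Icc_subset_Ici_self)
        (fun s hs => (hy.deriv s hs.1.le).hasDerivAt (Ici_mem_nhds hs.1)) ?_
      refine ContinuousOn.intervalIntegrable ?_
      rw [uIcc_of_le ht]
      exact (continuous_drift b p q v).comp_continuousOn (hy.continuousOn.mono Icc_subset_Ici_self)
    -- Sum and integral are exchanged under the geometric majorant `2 b v ^ n`.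
    have s3 : HasSum (fun n => ∫ s in (0 : ℝ)..t, k n s * v ^ n)
        (∫ s in (0 : ℝ)..t, drift b p q v (y s)) := by
      refine intervalIntegral.hasSum_integral_of_dominated_convergence
        (fun n _ => b * 2 * v ^ n) (fun n => ?_) (fun n => ?_) ?_ ?_ ?_
      · rw [uIoc_of_le ht]
        exact (((hkc n).mono (Ioc_subset_Icc_self.trans Icc_subset_Ici_self)).mul
          continuousOn_const).aestronglyMeasurable measurableSet_Ioc
      · refine Eventually.of_forall fun s hs => ?_
        rw [uIoc_of_le ht] at hs
        rw [norm_mul, Real.norm_of_nonneg (pow_nonneg hv.1.le n)]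
        have := hkb n s hs.1.le
        have := hv.1
        gcongr
        assumption
      · exact Eventually.of_forall fun s _ =>
          (summable_geometric_of_lt_one hv.1.le hv.2).mul_left _
      · exact intervalIntegrable_const
      · refine Eventually.of_forall fun s hs => ?_
        rw [uIoc_of_le ht] at hs
        exact hds s hs.1.le
    rw [hint] at s3
    have := (s1.sub s2).sub s3
    rw [sub_self] at this
    refine this.congr_fun fun n => ?_
    rw [intervalIntegral.integral_mul_const]
    ring
  linarith [eq_zero_of_hasSum_pow hz n]

theorem IsMarkovBranchingProcess.hasDerivAt_deathProb (h : Admissible b p q)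
    (hX : IsMarkovBranchingProcess (rates03 b p q) μ X) (hX0 : ∀ᵐ ω ∂μ, X 0 ω = 1) (n : ℕ)
    {t : ℝ} (ht : 0 < t) :
    HasDerivAt (deathProb μ X n) (b * (p * (if n = 1 then 1 else 0) - deathProb μ X n t +
        q * cubeCoeff (fun k => deathProb μ X k t) n)) t := by
  have hgc := hX.continuousOn_deathProb h hX0
  have hkc : ContinuousOn (fun s => b * (p * (if n = 1 then 1 else 0) - deathProb μ X n s +
        q * cubeCoeff (fun k => deathProb μ X k s) n)) (Ici 0) := by
    simp only [cubeCoeff]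
    fun_prop
  have hd := intervalIntegral.integral_hasDerivAt_right (a := 0) (b := t)
    ((hkc.mono (by rw [uIcc_of_le ht.le]; exact Icc_subset_Ici_self)).intervalIntegrable)
    ((hkc.mono Ioi_subset_Ici_self).stronglyMeasurableAtFilter isOpen_Ioi t ht)
    (hkc.continuousAt (Ici_mem_nhds ht))
  refine (hd.const_add (if n = 0 then 1 else 0)).congr_of_eventuallyEq ?_
  filter_upwards [Ioi_mem_nhds ht] with s hs
  exact hX.deathProb_eq_integral h hX0 n (le_of_lt hs)

/-! ### Closed formulas for the law of the death number. -/

theorem base_pos (h : Admissible b p q) (t : ℝ) : 0 < q + p * Real.exp (2 * b * t) :=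
  add_pos h.q_pos (mul_pos h.p_pos (Real.exp_pos _))

theorem hasDerivAt_base (b p q t : ℝ) :
    HasDerivAt (fun t => q + p * Real.exp (2 * b * t)) (2 * b * p * Real.exp (2 * b * t)) t := by
  have h1 : HasDerivAt (fun t => Real.exp (2 * b * t)) (Real.exp (2 * b * t) * (2 * b)) t := by
    simpa using ((hasDerivAt_id t).const_mul (2 * b)).exp
  exact ((h1.const_mul p).const_add q).congr_deriv (by ring)

/-- At `v = 0` the generating function reduces to `g_0` and the equation to the Bernoulli equation
`y' = b (-y + q y³)`; the claimed power solves it, and solutions are unique. -/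
theorem IsMarkovBranchingProcess.deathProb_zero_eq (h : Admissible b p q)
    (hX : IsMarkovBranchingProcess (rates03 b p q) μ X) (hX0 : ∀ᵐ ω ∂μ, X 0 ω = 1)
    {t : ℝ} (ht : 0 ≤ t) :
    deathProb μ X 0 t = (q + p * Real.exp (2 * b * t)) ^ (-(1 / 2) : ℝ) := by
  obtain ⟨y, hy⟩ := exists_isFlow (v := 0) (w := 1) h (by simp) (by simp)
  have h1 := hX.hasSum_deathProb h hX0 (by simp) hy ht
  have h2 := hasSum_single (f := fun n => deathProb μ X n t * (0 : ℝ) ^ n) 0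
    (fun n hn => by simp [hn])
  have h3 : deathProb μ X 0 t = y t := by simpa using h2.unique h1
  rw [h3]
  refine isFlow_unique (v := 0) (g := fun t => (q + p * Real.exp (2 * b * t)) ^ (-(1 / 2) : ℝ))
    h hy.deriv (fun s _ => ?_) ?_ ht
  · refine HasDerivAt.hasDerivWithinAt ?_
    have hA := base_pos h s
    refine ((hasDerivAt_base b p q s).rpow_const (Or.inl hA.ne')).congr_deriv ?_
    set A := q + p * Real.exp (2 * b * s) with hAdef
    have e1 : (A ^ (-(1 / 2) : ℝ)) ^ 3 = A ^ (-(1 / 2) - 1 : ℝ) := by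
      rw [← Real.rpow_natCast, ← Real.rpow_mul hA.le]; norm_num
    have e2 : A ^ (-(1 / 2) : ℝ) = A ^ (-(1 / 2) - 1 : ℝ) * A := by
      rw [Real.rpow_sub_one hA.ne']; field_simp
    have e3 : p * Real.exp (2 * b * s) = A - q := by rw [hAdef]; ring
    simp only [drift, e1]
    rw [e2, show 2 * b * p * Real.exp (2 * b * s) = 2 * b * (p * Real.exp (2 * b * s)) by ring, e3]
    ring
  · simp only [hy.init, mul_zero, Real.exp_zero, mul_one]
    rw [add_comm, h.add_eq_one, Real.one_rpow]

/-- Isolating `g_n` in the cube gives `g_n' = -b g_n + 3 b q g_0² g_n + F_n`. With `A = q + p exp (2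
b t)` one has `g_0² = A⁻¹`, and `m = exp (-2 b t) A ^ (3/2)` satisfies `m' = m (b - 3 b q / A)`, so
`(m g_n)' = m F_n`. -/
theorem IsMarkovBranchingProcess.deathProb_eq (h : Admissible b p q)
    (hX : IsMarkovBranchingProcess (rates03 b p q) μ X) (hX0 : ∀ᵐ ω ∂μ, X 0 ω = 1) {n : ℕ}
    (hn : 1 ≤ n) {t : ℝ} (ht : 0 ≤ t) :
    deathProb μ X n t =
      Real.exp (2 * b * t) * (q + p * Real.exp (2 * b * t)) ^ (-(3 / 2) : ℝ) *
        ∫ s in (0 : ℝ)..t,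
          Real.exp (-(2 * b * s)) * (q + p * Real.exp (2 * b * s)) ^ (3 / 2 : ℝ) *
            (b * p * (if n = 1 then 1 else 0) +
              b * q * cubicConv (fun k => deathProb μ X k s) n) := by
  set m : ℝ → ℝ := fun s => Real.exp (-(2 * b * s)) * (q + p * Real.exp (2 * b * s)) ^ (3 / 2 : ℝ)
    with hm
  have hgc := hX.continuousOn_deathProb h hX0
  have hmd : ∀ s, HasDerivAt m (m s * (b - 3 * b * q * (q + p * Real.exp (2 * b * s))⁻¹)) s := by
    intro s
    have hA := base_pos h s
    have h1 : HasDerivAt (fun s => Real.exp (-(2 * b * s)))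
        (Real.exp (-(2 * b * s)) * (-(2 * b))) s := by
      simpa using ((hasDerivAt_id s).const_mul (2 * b)).neg.exp
    refine (h1.mul ((hasDerivAt_base b p q s).rpow_const (p := 3 / 2) (Or.inl hA.ne'))).congr_deriv ?_
    simp only [hm]
    set A := q + p * Real.exp (2 * b * s) with hAdef
    have e3 : p * Real.exp (2 * b * s) = A - q := by rw [hAdef]; ring
    rw [show 2 * b * p * Real.exp (2 * b * s) = 2 * b * (p * Real.exp (2 * b * s)) by ring, e3,
      Real.rpow_sub_one hA.ne']
    field_simp
    ring
  have hmc : Continuous m := continuous_iff_continuousAt.2 fun s => (hmd s).continuousAt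
  have hFc : ContinuousOn (fun s => m s * (b * p * (if n = 1 then 1 else 0) +
      b * q * cubicConv (fun k => deathProb μ X k s) n)) (Icc 0 t) := by
    have hgc' : ∀ k, ContinuousOn (deathProb μ X k) (Icc 0 t) := fun k =>
      (hgc k).mono Icc_subset_Ici_self
    have := hmc.continuousOn (s := Icc 0 t)
    simp only [cubicConv]
    fun_prop
  have hder : ∀ s ∈ Ioo 0 t, HasDerivAt (fun s => m s * deathProb μ X n s)
      (m s * (b * p * (if n = 1 then 1 else 0) +
        b * q * cubicConv (fun k => deathProb μ X k s) n)) s := by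
    intro s hs
    have hA := base_pos h s
    refine ((hmd s).mul (hX.hasDerivAt_deathProb h hX0 n hs.1)).congr_deriv ?_
    have e0 : deathProb μ X 0 s ^ 2 = (q + p * Real.exp (2 * b * s))⁻¹ := by
      rw [hX.deathProb_zero_eq h hX0 hs.1.le, ← Real.rpow_natCast, ← Real.rpow_mul hA.le,
        ← Real.rpow_neg_one]
      norm_num
    rw [cubeCoeff_eq_cubicConv_add _ hn, e0]
    ring
  have hint := intervalIntegral.integral_eq_sub_of_hasDerivAt_of_le ht
    (hmc.continuousOn.mul ((hgc n).mono Icc_subset_Ici_self)) hder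
    (ContinuousOn.intervalIntegrable (by rwa [uIcc_of_le ht]))
  have h0 : deathProb μ X n 0 = 0 := by
    rw [hX.deathProb_eq_integral h hX0 n le_rfl, if_neg (by omega)]; simp
  simp only [Pi.mul_apply, h0, mul_zero, sub_zero] at hint
  rw [hint]
  have hA := base_pos h t
  have e : Real.exp (2 * b * t) * (q + p * Real.exp (2 * b * t)) ^ (-(3 / 2) : ℝ) * m t = 1 := by
    simp only [hm]
    rw [mul_mul_mul_comm, ← Real.exp_add, ← Real.rpow_add hA]
    simp
  rw [← mul_assoc, e, one_mul]

end BranchingLaw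

/-! ### Extinction -/

/-- The state `0` is absorbing as soon as it is so along a dense set of times. -/
theorem IsCadlagPath.absorbed {x : ℝ≥0 → ℕ} (hx : IsCadlagPath x) {D : Set ℝ≥0} (hD : Dense D)
    (h : ∀ s ∈ D, ∀ t ∈ D, s ≤ t → x s = 0 → x t = 0) {s t : ℝ≥0} (hst : s ≤ t) (hs : x s = 0) :
    x t = 0 := by
  have right : ∀ a : ℝ≥0, ∃ c > a, ∀ r ∈ Ioo a c, x r = x a := by
    intro a
    obtain ⟨l, hl⟩ := hx.exists_piecewise a
    have : ∀ᶠ r in 𝓝[>] a, x r = x a := by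
      filter_upwards [nhdsWithin_le_nhds hl, self_mem_nhdsWithin] with r hr hra
      exact hr.2 (le_of_lt hra)
    obtain ⟨c, hc, hc'⟩ := mem_nhdsGT_iff_exists_Ioo_subset.1 this
    exact ⟨c, hc, hc'⟩
  rcases hst.eq_or_lt with rfl | hlt
  · exact hs
  obtain ⟨c, hc, hxc⟩ := right s
  obtain ⟨d, hd, hxd⟩ := right t
  -- Both times are replaced by points of `D` slightly to their right, where the path has the same
  -- values.
  obtain ⟨s', hs'D, hs'⟩ := hD.exists_between (lt_min hc hlt)
  obtain ⟨t', ht'D, ht'⟩ := hD.exists_between hd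
  rw [← hxd t' ht']
  refine h s' hs'D t' ht'D ((hs'.2.trans_le (min_le_right _ _)).le.trans ht'.1.le) ?_
  rw [hxc s' ⟨hs'.1, hs'.2.trans_le (min_le_left _ _)⟩, hs]

/-- By right-continuity the infimum of the zero set is attained. -/
theorem exists_forall_eq_zero_iff {x : ℝ≥0 → ℕ} (hx : IsCadlagPath x)
    (habs : ∀ s t, s ≤ t → x s = 0 → x t = 0) {t₀ : ℝ≥0} (h0 : x t₀ = 0) :
    ∃ T : ℝ≥0, ∀ t, x t = 0 ↔ T ≤ t := by
  have hne : {t | x t = 0}.Nonempty := ⟨t₀, h0⟩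
  refine ⟨sInf {t | x t = 0}, fun t => ⟨fun ht => csInf_le (OrderBot.bddBelow _) ht, fun ht => ?_⟩⟩
  refine habs _ _ ht ?_
  set T := sInf {t | x t = 0} with hT
  obtain ⟨l, hl⟩ := hx.exists_piecewise T
  have hev : ∀ᶠ r in 𝓝[≥] T, x r = x T := by
    filter_upwards [nhdsWithin_le_nhds hl, self_mem_nhdsWithin] with r hr hra using hr.2 hra
  obtain ⟨c, hc, hc'⟩ := mem_nhdsGE_iff_exists_Ico_subset.1 hev
  obtain ⟨r, hr, hrc⟩ := exists_lt_of_csInf_lt hne hc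
  have : x r = x T := hc' ⟨csInf_le (OrderBot.bddBelow _) hr, hrc⟩
  rw [← this]
  exact hr

theorem deathTimes_eq_of_absorbed {x : ℝ≥0 → ℕ} {T t : ℝ≥0} (hT : ∀ r, T ≤ r → x r = 0)
    (ht : T ≤ t) : deathTimes x t = deathTimes x T := by
  refine Subset.antisymm (fun c hc => ⟨hc.1, ?_, hc.2.2⟩) (deathTimes_mono x ht)
  by_contra hlt
  rw [not_le] at hlt
  refine not_eventually_of_const hc.1 ?_ hc.2.2
  filter_upwards [Ioo_mem_nhdsLT hlt] with r hr
  rw [hT r hr.1.le, hT c hlt.le]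

theorem mem_extinction_iff {Ω : Type*} {X : ℝ≥0 → Ω → ℕ} {ω : Ω} : ω ∈ extinction X ↔ ∃ t, X t ω = 0 := by
  change extinctionTime X ω < ∞ ↔ _
  simp [extinctionTime, iInf_lt_iff]

theorem totalDeaths_eq {Ω : Type*} {X : ℝ≥0 → Ω → ℕ} {ω : Ω} (hx : IsCadlagPath fun t => X t ω)
    (habs : ∀ s t, s ≤ t → X s ω = 0 → X t ω = 0) {t : ℝ≥0} (ht : X t ω = 0) :
    totalDeaths X ω = deathNumber X t ω := by
  obtain ⟨T, hT⟩ := exists_forall_eq_zero_iff hx habs ht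
  have e : extinctionTime X ω = T := by
    refine le_antisymm (iInf₂_le T ((hT T).2 le_rfl)) (le_iInf₂ fun s hs => ?_)
    exact ENNReal.coe_le_coe.2 ((hT s).1 hs)
  rw [totalDeaths, e, ENNReal.toNNReal_coe, deathNumber, deathNumber,
    deathTimes_eq_of_absorbed (fun r hr => (hT r).2 hr) ((hT t).1 ht)]

section BranchingLaw

variable {Ω : Type*} [MeasurableSpace Ω] {μ : Measure Ω} {X : ℝ≥0 → Ω → ℕ} {b p q : ℝ}
  [IsProbabilityMeasure μ]

/-- For a fixed pair of times this is the Markov property with `P t 0 0 = 1`. A countable dense set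
of times keeps the exceptional set null, and path regularity does the rest. -/
theorem IsMarkovBranchingProcess.ae_absorbed (h : Admissible b p q)
    (hX : IsMarkovBranchingProcess (rates03 b p q) μ X) :
    ∀ᵐ ω ∂μ, ∀ s t, s ≤ t → X s ω = 0 → X t ω = 0 := by
  obtain ⟨P, hP, hF, hM⟩ := hX.markov
  obtain ⟨D, hDc, hD⟩ := TopologicalSpace.exists_countable_dense ℝ≥0
  have key : ∀ s t : ℝ≥0, s ≤ t → ∀ᵐ ω ∂μ, X s ω = 0 → X t ω = 0 := by
    intro s t hst
    have hj : ∀ j : ℕ, j ≠ 0 → ∀ᵐ ω ∂μ, ¬ (X s ω = 0 ∧ X t ω = j) := by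
      intro j hj
      have h0 : P (t - s : ℝ≥0) 0 j = 0 := by
        refine le_antisymm ?_ (hP.nonneg _ (t - s).coe_nonneg _ _)
        have := hP.le_one_sub (t - s).coe_nonneg (i := 0) hj
        rwa [transition_zero_zero h hP hF (t - s).coe_nonneg, sub_self] at this
      have := hM s (t - s) 0 j univ MeasurableSet.univ
      rw [h0, mul_zero, add_tsub_cancel_of_le hst, univ_inter] at this
      rw [measureReal_eq_zero_iff] at this
      exact measure_eq_zero_iff_ae_notMem.1 this
    have := ae_all_iff.2 fun j => ae_all_iff.2 (hj j)
    filter_upwards [this] with ω hω hs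
    by_contra ht
    exact hω _ ht ⟨hs, rfl⟩
  have hall : ∀ᵐ ω ∂μ, ∀ s ∈ D, ∀ t ∈ D, s ≤ t → X s ω = 0 → X t ω = 0 := by
    rw [ae_ball_iff hDc]
    intro s _
    rw [ae_ball_iff hDc]
    intro t _
    by_cases hst : s ≤ t
    · filter_upwards [key s t hst] with ω hω _ using hω
    · exact Eventually.of_forall fun ω h => absurd h hst
  filter_upwards [hall, hX.cadlag] with ω h1 h2 s t hst hs
  exact h2.absorbed hD h1 hst hs

/-- On extinction the total number of deaths is read off at any time at which `X` vanishes. -/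
theorem IsMarkovBranchingProcess.ae_totalDeaths_eq (h : Admissible b p q)
    (hX : IsMarkovBranchingProcess (rates03 b p q) μ X) :
    ∀ᵐ ω ∂μ, ω ∈ extinction X → ∀ᶠ t in atTop, X t ω = 0 ∧ deathNumber X t ω = totalDeaths X ω := by
  filter_upwards [hX.cadlag, hX.ae_absorbed h] with ω h1 h2 hω
  obtain ⟨s, hs⟩ := mem_extinction_iff.1 hω
  filter_upwards [eventually_ge_atTop s] with t ht
  have ht0 := h2 s t ht hs
  exact ⟨ht0, (totalDeaths_eq h1 h2 ht0).symm⟩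

/-- Extinction is an uncountable union over times; absorption makes it almost surely the union over
integer times. -/
theorem IsMarkovBranchingProcess.nullMeasurableSet_extinction (h : Admissible b p q)
    (hX : IsMarkovBranchingProcess (rates03 b p q) μ X) :
    NullMeasurableSet (extinction X) μ := by
  have hm : MeasurableSet (⋃ n : ℕ, {ω | X n ω = 0}) :=
    MeasurableSet.iUnion fun n => (hX.measurable n) (measurableSet_singleton 0)
  refine hm.nullMeasurableSet.congr ?_
  filter_upwards [hX.ae_totalDeaths_eq h] with ω hω
  refine propext ⟨fun hn => ?_, fun he => ?_⟩
  · obtain ⟨n, hn⟩ := mem_iUnion.1 hn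
    exact mem_extinction_iff.2 ⟨n, hn⟩
  · obtain ⟨n, hn⟩ := (tendsto_natCast_atTop_atTop.eventually (hω he)).exists
    exact mem_iUnion.2 ⟨n, hn.1⟩

theorem IsMarkovBranchingProcess.aemeasurable_totalDeaths (h : Admissible b p q)
    (hX : IsMarkovBranchingProcess (rates03 b p q) μ X) :
    AEMeasurable (totalDeaths X) (μ.restrict (extinction X)) := by
  refine aemeasurable_of_tendsto_metrizable_ae (u := atTop)
    (f := fun (n : ℕ) ω => deathNumber X n ω)
    (fun n => (hX.aemeasurable_deathNumber n).restrict) ?_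
  filter_upwards [ae_restrict_of_ae (hX.ae_totalDeaths_eq h),
    ae_restrict_mem₀ (hX.nullMeasurableSet_extinction h)] with ω hω he
  exact tendsto_const_nhds.congr'
    ((tendsto_natCast_atTop_atTop.eventually (hω he)).mono fun n hn => hn.2.symm)

/-- Since `0 ^ X t` is the indicator of `X t = 0`, the flow from `0` is `E[v ^ Y(t); X(t) = 0]`. Its
convergence comes from dominated convergence on the probability space, not from an analysis of the
equation. -/
theorem IsMarkovBranchingProcess.tendsto_flow (h : Admissible b p q)
    (hX : IsMarkovBranchingProcess (rates03 b p q) μ X) (hX0 : ∀ᵐ ω ∂μ, X 0 ω = 1)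
    {v : ℝ} (hv : v ∈ Icc (0 : ℝ) 1) {y : ℝ → ℝ} (hy : IsFlow b p q v 0 y) :
    Tendsto y atTop (𝓝 (∫ ω in extinction X, v ^ totalDeaths X ω ∂μ)) := by
  have h0 : (0 : ℝ) ∈ Icc (0 : ℝ) 1 := by simp
  have hlim : Tendsto (fun t : ℝ => ∫ ω, v ^ deathNumber X t.toNNReal ω * 0 ^ X t.toNNReal ω ∂μ)
      atTop (𝓝 (∫ ω, (extinction X).indicator (fun ω => v ^ totalDeaths X ω) ω ∂μ)) := by
    refine tendsto_integral_filter_of_dominated_convergence (fun _ => 1)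
      (Eventually.of_forall fun t => ?_) (Eventually.of_forall fun t => Eventually.of_forall
        fun ω => ?_) (integrable_const _) ?_
    · exact (integrable_pow_mul_pow (hX.aemeasurable_deathNumber _)
        (hX.measurable _).aemeasurable hv h0).aestronglyMeasurable
    · have h1 := pow_mem_Icc hv (deathNumber X t.toNNReal ω)
      have h2 := pow_mem_Icc h0 (X t.toNNReal ω)
      rw [Real.norm_of_nonneg (mul_nonneg h1.1 h2.1)]
      exact mul_le_one₀ h1.2 h2.1 h2.2
    · filter_upwards [hX.ae_totalDeaths_eq h] with ω hω
      by_cases he : ω ∈ extinction X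
      · rw [indicator_of_mem he]
        refine tendsto_const_nhds.congr' ?_
        filter_upwards [Real.tendsto_toNNReal_atTop.eventually (hω he)] with t ht
        simp [ht.1, ht.2]
      · rw [indicator_of_notMem he]
        refine tendsto_const_nhds.congr fun t => ?_
        have : X t.toNNReal ω ≠ 0 := fun h => he (mem_extinction_iff.2 ⟨_, h⟩)
        simp [this]
  rw [integral_indicator₀ (hX.nullMeasurableSet_extinction h)] at hlim
  refine hlim.congr' ?_
  filter_upwards [eventually_ge_atTop 0] with t ht
  rw [hX.integral_pow_mul_pow h hX0 hv zero_lt_one hy, Real.coe_toNNReal t ht]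

/-- The generating function of the total number of deaths is a stationary point of the flow. -/
theorem IsMarkovBranchingProcess.drift_setIntegral_eq_zero (h : Admissible b p q)
    (hX : IsMarkovBranchingProcess (rates03 b p q) μ X) (hX0 : ∀ᵐ ω ∂μ, X 0 ω = 1)
    {v : ℝ} (hv : v ∈ Icc (0 : ℝ) 1) :
    drift b p q v (∫ ω in extinction X, v ^ totalDeaths X ω ∂μ) = 0 := by
  obtain ⟨y, hy⟩ := exists_isFlow (w := 0) h hv (by simp)
  exact hy.drift_eq_zero (hX.tendsto_flow h hX0 hv hy)

/-! ### The law of the total number of deaths and the extinction probability. -/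

theorem IsMarkovBranchingProcess.hasSum_totalDeaths (h : Admissible b p q)
    (hX : IsMarkovBranchingProcess (rates03 b p q) μ X) {v : ℝ} (hv : v ∈ Icc (0 : ℝ) 1) :
    HasSum (fun n => μ.real (extinction X ∩ {ω | totalDeaths X ω = n}) * v ^ n)
      (∫ ω in extinction X, v ^ totalDeaths X ω ∂μ) := by
  refine (hasSum_measureReal_fiber (hX.aemeasurable_totalDeaths h) (pow_mem_Icc hv)).congr_fun
    fun n => ?_
  rw [measureReal_def, measureReal_def, Measure.restrict_apply₀' (hX.nullMeasurableSet_extinction h),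
    inter_comm]

theorem eq_of_drift_eq_zero (h : Admissible b p q) {v u : ℝ} (hu : drift b p q v u = 0) :
    p * v - u + q * u ^ 3 = 0 :=
  (mul_eq_zero.1 hu).resolve_left h.b_pos.ne'

/-- At `v = 0` stationarity reads `H (1 - q H²) = 0`, and the second factor is positive because `H ≤
1` and `q < 1`. -/
theorem IsMarkovBranchingProcess.totalDeaths_zero (h : Admissible b p q)
    (hX : IsMarkovBranchingProcess (rates03 b p q) μ X) (hX0 : ∀ᵐ ω ∂μ, X 0 ω = 1) :
    μ.real (extinction X ∩ {ω | totalDeaths X ω = 0}) = 0 := by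
  have hv : (0 : ℝ) ∈ Icc (0 : ℝ) 1 := by simp
  have h1 := hX.hasSum_totalDeaths h hv
  have h2 := hasSum_single (f := fun n => μ.real (extinction X ∩ {ω | totalDeaths X ω = n}) *
    (0 : ℝ) ^ n) 0 (fun n hn => by simp [hn])
  have h3 := eq_of_drift_eq_zero h (hX.drift_setIntegral_eq_zero h hX0 hv)
  rw [h1.unique h2, pow_zero, mul_one] at h3
  set H := μ.real (extinction X ∩ {ω | totalDeaths X ω = 0}) with hH
  have hH0 : 0 ≤ H := measureReal_nonneg
  have hH1 : H ≤ 1 := measureReal_le_one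
  have hq : q < 1 := by linarith [h.p_pos, h.add_eq_one]
  have h4 : H * (1 - q * H ^ 2) = 0 := by linarith [h3]
  refine (mul_eq_zero.1 h4).resolve_right ?_
  have : q * H ^ 2 ≤ q := mul_le_of_le_one_right h.q_pos.le (pow_le_one₀ hH0 hH1)
  linarith

theorem IsMarkovBranchingProcess.totalDeaths_eq_cubeCoeff (h : Admissible b p q)
    (hX : IsMarkovBranchingProcess (rates03 b p q) μ X) (hX0 : ∀ᵐ ω ∂μ, X 0 ω = 1) (n : ℕ) :
    μ.real (extinction X ∩ {ω | totalDeaths X ω = n}) = p * (if n = 1 then 1 else 0) +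
      q * cubeCoeff (fun k => μ.real (extinction X ∩ {ω | totalDeaths X ω = k})) n := by
  set g : ℕ → ℝ := fun k => μ.real (extinction X ∩ {ω | totalDeaths X ω = k}) with hg
  have key : ∀ v ∈ Ioo (0 : ℝ) 1,
      HasSum (fun n => (p * (if n = 1 then 1 else 0) - g n + q * cubeCoeff g n) * v ^ n) 0 := by
    intro v hv
    have hv' := Ioo_subset_Icc_self hv
    have a1 := hX.hasSum_totalDeaths h hv'
    have a3 : HasSum (fun n : ℕ => (if n = 1 then (1 : ℝ) else 0) * v ^ n) v := by
      simpa using hasSum_single (f := fun n : ℕ => (if n = 1 then (1 : ℝ) else 0) * v ^ n) 1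
        (fun n hn => by simp [hn])
    have := ((a3.mul_left p).sub a1).add ((hasSum_cubeCoeff a1).mul_left q)
    rw [eq_of_drift_eq_zero h (hX.drift_setIntegral_eq_zero h hX0 hv')] at this
    refine this.congr_fun fun n => ?_
    simp only [hg]
    ring
  linarith [eq_zero_of_hasSum_pow key n]

theorem IsMarkovBranchingProcess.totalDeaths_one (h : Admissible b p q)
    (hX : IsMarkovBranchingProcess (rates03 b p q) μ X) (hX0 : ∀ᵐ ω ∂μ, X 0 ω = 1) :
    μ.real (extinction X ∩ {ω | totalDeaths X ω = 1}) = p := by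
  rw [hX.totalDeaths_eq_cubeCoeff h hX0, cubeCoeff_eq_cubicConv_add _ le_rfl,
    hX.totalDeaths_zero h hX0]
  -- For `n = 1` every index would be `0`, so no triple has sum `1`.
  simp [cubicConv, Finset.sum_filter]

theorem IsMarkovBranchingProcess.totalDeaths_recursion (h : Admissible b p q)
    (hX : IsMarkovBranchingProcess (rates03 b p q) μ X) (hX0 : ∀ᵐ ω ∂μ, X 0 ω = 1) {n : ℕ}
    (hn : 2 ≤ n) :
    μ.real (extinction X ∩ {ω | totalDeaths X ω = n}) =
      q * cubicConv (fun k => μ.real (extinction X ∩ {ω | totalDeaths X ω = k})) n := by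
  rw [hX.totalDeaths_eq_cubeCoeff h hX0, cubeCoeff_eq_cubicConv_add _ (by omega),
    hX.totalDeaths_zero h hX0, if_neg (by omega)]
  ring

theorem isFlow_const {v u : ℝ} (hu : u ∈ Icc (0 : ℝ) 1) (h0 : drift b p q v u = 0) :
    IsFlow b p q v u (fun _ => u) where
  init := rfl
  deriv t _ := by rw [h0]; exact hasDerivWithinAt_const _ _ _
  mem _ _ := hu

/-- The extinction probability is the least nonnegative root. -/
theorem IsMarkovBranchingProcess.isLeast_extinction (h : Admissible b p q)
    (hX : IsMarkovBranchingProcess (rates03 b p q) μ X) (hX0 : ∀ᵐ ω ∂μ, X 0 ω = 1) :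
    IsLeast {u : ℝ | 0 ≤ u ∧ p - u + q * u ^ 3 = 0} (μ.real (extinction X)) := by
  have h1 : (1 : ℝ) ∈ Icc (0 : ℝ) 1 := by simp
  have e : ∫ ω in extinction X, (1 : ℝ) ^ totalDeaths X ω ∂μ = μ.real (extinction X) := by simp
  have hr := eq_of_drift_eq_zero h (hX.drift_setIntegral_eq_zero h hX0 h1)
  rw [e, mul_one] at hr
  refine ⟨⟨measureReal_nonneg, hr⟩, fun u hu => ?_⟩
  rcases le_or_gt 1 u with hu1 | hu1
  · exact measureReal_le_one.trans hu1
  have hu' : u ∈ Icc (0 : ℝ) 1 := ⟨hu.1, hu1.le⟩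
  -- A root `u < 1` is a constant flow, so `u = E[u ^ X(t)] ≥ E[0 ^ X(t)]`, and the right side tends
  -- to the extinction probability.
  have hflow : IsFlow b p q 1 u (fun _ => u) :=
    isFlow_const hu' (by rw [drift, mul_one, hu.2, mul_zero])
  obtain ⟨y, hy⟩ := exists_isFlow (v := 1) (w := 0) h h1 (by simp)
  have hlim := hX.tendsto_flow h hX0 h1 hy
  rw [e] at hlim
  refine le_of_tendsto hlim ?_
  filter_upwards [eventually_ge_atTop 0] with t ht
  lift t to ℝ≥0 using ht
  rw [← hX.integral_pow_mul_pow h hX0 h1 zero_lt_one hy t,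
    ← hX.integral_pow_mul_pow h hX0 h1 hu1 hflow t]
  refine integral_mono (integrable_pow_mul_pow (hX.aemeasurable_deathNumber _)
    (hX.measurable _).aemeasurable h1 (by simp)) (integrable_pow_mul_pow
    (hX.aemeasurable_deathNumber _) (hX.measurable _).aemeasurable h1 hu') fun ω => ?_
  simp only [one_pow, one_mul]
  gcongr
  exact hu.1

/-- Besides `1`, the roots are those of `q u² + q u - p`, which is `-p < 0` at `0` and `3 q - 1` at
`1`; being increasing on `[0, 1]`, it has a zero below `1` exactly when `q > 1 / 3`. -/
theorem isLeast_root_eq_one_iff (h : Admissible b p q) {ρ : ℝ}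
    (hρ : IsLeast {u : ℝ | 0 ≤ u ∧ p - u + q * u ^ 3 = 0} ρ) : ρ = 1 ↔ q ≤ 1 / 3 := by
  have hq := h.q_pos
  have hp : p = 1 - q := by linarith [h.add_eq_one]
  have fac : ∀ u : ℝ, p - u + q * u ^ 3 = (u - 1) * (q * u ^ 2 + q * u - p) := fun u => by
    rw [hp]; ring
  constructor
  · intro h1
    by_contra hlt
    rw [not_le] at hlt
    obtain ⟨u, hu, hu0⟩ := intermediate_value_Icc (zero_le_one' ℝ)
      (f := fun u => q * u ^ 2 + q * u - p) (by fun_prop)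
      (show (0 : ℝ) ∈ Icc _ _ by constructor <;> norm_num <;> linarith [h.p_pos])
    simp only at hu0
    have h2 : (1 : ℝ) ≤ u := h1 ▸ hρ.2 ⟨hu.1, by rw [fac, hu0, mul_zero]⟩
    have h3 : u = 1 := le_antisymm hu.2 h2
    rw [h3] at hu0
    linarith
  · intro hle
    have hρ1 : ρ ≤ 1 := hρ.2 ⟨zero_le_one, by rw [fac]; ring⟩
    by_contra hne
    have hlt : ρ < 1 := lt_of_le_of_ne hρ1 hne
    have := hρ.1.2
    rw [fac] at this
    have h2 := (mul_eq_zero.1 this).resolve_left (by linarith)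
    have h3 := hρ.1.1
    have h4 : ρ ^ 2 ≤ ρ := by nlinarith
    nlinarith

end BranchingLaw

end BranchingDeaths

theorem theorem3p5 {Ω : Type*} [MeasurableSpace Ω] (μ : Measure Ω) [IsProbabilityMeasure μ]
    (b p q : ℝ) (hb : 0 < b) (hp : p ∈ Set.Ioo (0 : ℝ) 1) (hpq : p + q = 1)
    (X : ℝ≥0 → Ω → ℕ)
    (hX : BranchingDeaths.IsMarkovBranchingProcess (BranchingDeaths.rates03 b p q) μ X)
    (hX0 : ∀ᵐ ω ∂μ, X 0 ω = 1) :
    -- the law and the generating function of the death number until time `t`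
    ((∀ t : ℝ≥0, AEMeasurable (BranchingDeaths.deathNumber X t) μ) ∧
      (∀ v ∈ Set.Icc (0 : ℝ) 1, ∃ G : ℝ → ℝ,
        BranchingDeaths.IsSolution b p q v G ∧
        (∀ y : ℝ → ℝ, BranchingDeaths.IsSolution b p q v y → ∀ t : ℝ, 0 ≤ t → y t = G t) ∧
        ∀ t : ℝ≥0, (∫ ω, v ^ BranchingDeaths.deathNumber X t ω ∂μ) = G t ∧
          HasSum (fun n : ℕ => BranchingDeaths.deathProb μ X n t * v ^ n) (G t)) ∧
      (∀ n : ℕ, ContinuousOn (BranchingDeaths.deathProb μ X n) (Set.Ici 0)) ∧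
      (∀ t : ℝ, 0 ≤ t →
        BranchingDeaths.deathProb μ X 0 t = (q + p * Real.exp (2 * b * t)) ^ (-(1 / 2) : ℝ)) ∧
      (∀ n : ℕ, 1 ≤ n → ∀ t : ℝ, 0 ≤ t →
        BranchingDeaths.deathProb μ X n t =
          Real.exp (2 * b * t) * (q + p * Real.exp (2 * b * t)) ^ (-(3 / 2) : ℝ) *
            ∫ s in (0 : ℝ)..t,
              Real.exp (-(2 * b * s)) * (q + p * Real.exp (2 * b * s)) ^ (3 / 2 : ℝ) *
                (b * p * (if n = 1 then 1 else 0) +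
                  b * q *
                    BranchingDeaths.cubicConv (fun k => BranchingDeaths.deathProb μ X k s) n))) ∧
    -- the law and the generating function of the death number at extinction
    (NullMeasurableSet (BranchingDeaths.extinction X) μ ∧
      AEMeasurable (BranchingDeaths.totalDeaths X) (μ[|BranchingDeaths.extinction X]) ∧
      ∃ (ρ : ℝ) (g : ℕ → ℝ),
        IsLeast {u : ℝ | 0 ≤ u ∧ p - u + q * u ^ 3 = 0} ρ ∧
        μ.real (BranchingDeaths.extinction X) = ρ ∧
        (ρ = 1 ↔ q ≤ 1 / 3) ∧
        g 0 = 0 ∧ g 1 = p ∧ (∀ n : ℕ, 2 ≤ n → g n = q * BranchingDeaths.cubicConv g n) ∧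
        (∀ n : ℕ,
          μ.real (BranchingDeaths.extinction X ∩ {ω | BranchingDeaths.totalDeaths X ω = n})
            = g n) ∧
        (∀ v ∈ Set.Icc (0 : ℝ) 1,
          HasSum (fun n : ℕ => g n * v ^ n)
            (∫ ω in BranchingDeaths.extinction X, v ^ BranchingDeaths.totalDeaths X ω ∂μ)) ∧
        (∀ v ∈ Set.Icc (0 : ℝ) 1,
          (∫ ω, v ^ BranchingDeaths.totalDeaths X ω ∂(μ[|BranchingDeaths.extinction X])) =
            ρ⁻¹ * ∑' n : ℕ, g n * v ^ n)) := by
  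
  have h : BranchingDeaths.Admissible b p q := ⟨hb, hp.1, by linarith [hp.2], hpq⟩
  refine ⟨⟨hX.aemeasurable_deathNumber, fun v hv => ?_, hX.continuousOn_deathProb h hX0,
    fun t ht => hX.deathProb_zero_eq h hX0 ht, fun n hn t ht => hX.deathProb_eq h hX0 hn ht⟩,
    hX.nullMeasurableSet_extinction h, (hX.aemeasurable_totalDeaths h).smul_measure _,
    μ.real (BranchingDeaths.extinction X),
    fun n => μ.real (BranchingDeaths.extinction X ∩ {ω | BranchingDeaths.totalDeaths X ω = n}),
    hX.isLeast_extinction h hX0, rfl,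
    BranchingDeaths.isLeast_root_eq_one_iff h (hX.isLeast_extinction h hX0),
    hX.totalDeaths_zero h hX0, hX.totalDeaths_one h hX0,
    fun n hn => hX.totalDeaths_recursion h hX0 hn, fun n => rfl,
    fun v hv => hX.hasSum_totalDeaths h hv, fun v hv => ?_⟩
  · obtain ⟨G, hG⟩ := BranchingDeaths.exists_isFlow (w := 1) h hv (by simp)
    exact ⟨G, ⟨hG.init, hG.deriv⟩,
      fun y hy t ht => BranchingDeaths.isFlow_unique h hy.2 hG.deriv (hy.1.trans hG.init.symm) ht,
      fun t => ⟨hX.integral_pow_deathNumber h hX0 hv hG t,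
        hX.hasSum_deathProb h hX0 hv hG t.coe_nonneg⟩⟩
  · rw [(hX.hasSum_totalDeaths h hv).tsum_eq, ProbabilityTheory.cond, integral_smul_measure,
      ENNReal.toReal_inv, smul_eq_mul]
    rfl
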